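/- Throughout, $G$ is a countable discrete group, C*-algebras are not assumed unital, ideals are closed and two-sided, and an action of $G$ on a C*-algebra $A$ is a homomorphism $\alpha : G\to\mathrm{Aut}(A)$. Definitions. Let $A_\infty := \ell^\infty(\mathbb{N},A)/c_0(\mathbb{N},A)$, which contains $A$ as the constant sequences. For a C*-subalgebra $D\subset A$ put $$F(D,A) := (A_\infty\cap D')/\{x\in A_\infty : xd=dx=0 \text{ for all } d\in D\};$$ it is unital if $D$ is separable. If $D$ is $\alpha$-invariant, $\alpha$ induces an action $\widetilde\alpha_\infty$ of $G$ on $F(D,A)$. A contractive completely positive (c.c.p.) map $\varphi$ has order zero if $\varphi(a)\perp\varphi(b)$ whenever $a\perp b$, where $a\perp b$ means $ab=ba=a^*b=b^*a=0$. For a subgroup $H\le G$ of finite index let $\sigma^H$ be the action of $G$ on $C(G/H)$ given by $\sigma^H_t(f)(gH)=f(t^{-1}gH)$. Then $\mathrm{dr}(\alpha,H)$ is the least integer $d\geq 0$ such that for every separable $\alpha$-invariant C*-subalgebra $D\subset A$ there are $d+1$ equivariant c.c.p. order zero maps $$\varphi_0,\dots,\varphi_d : (C(G/H),\sigma^H)\to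 (F(D,A),\widetilde\alpha_\infty)\quad\text{with}\quad \sum_{\ell=0}^d\varphi_\ell(1)=1_{F(D,A)},$$ and $\mathrm{dr}(\alpha,H)=\infty$ if there is no such $d$. Requiring in addition that the ranges of $\varphi_0,\dots,\varphi_d$ commute pairwise defines $\mathrm{dr}^c(\alpha,H)$. The Rokhlin dimension of $\alpha$, without and with commuting towers, is $$\mathrm{dr}(\alpha)=\sup_H \mathrm{dr}(\alpha,H),\qquad \mathrm{dr}^c(\alpha)=\sup_H \mathrm{dr}^c(\alpha,H),$$ the suprema being over all subgroups $H\le G$ of finite index. Theorem. Let $G$ be a countable, discrete, amenable, residually finite group and let $\alpha$ be an action of $G$ on a C*-algebra $A$. 1. Let $\beta$ be an action of $G$ on a C*-algebra $B$, and let $A\otimes B$ be any completion of the algebraic tensor product $A\odot B$ in a C*-norm such that the automorphisms $\alpha_g\otimes\beta_g$ of $A\odot B$ extend to an action $\alpha\otimes\beta$ of $G$ on $A\otimes B$. Then $\mathrm{dr}(\alpha\otimes\beta)\le\min\{\mathrm{dr}(\alpha),\mathrm{dr}(\beta)\}$ and $\mathrm{dr}^c(\alpha\otimes\beta)\le\min\{\mathrm{dr}^c(\alpha),\mathrm{dr}^c(\beta)\}$.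 2. Let $I$ be an $\alpha$-invariant ideal of $A$ and let $\overline\alpha$ be the induced action on $A/I$. Then $\mathrm{dr}(\overline\alpha)\le\mathrm{dr}(\alpha)$ and $\mathrm{dr}^c(\overline\alpha)\le\mathrm{dr}^c(\alpha)$. 3. Let $D$ be an $\alpha$-invariant hereditary C*-subalgebra of $A$ and let $\alpha|_D$ be the restricted action on $D$. Then $\mathrm{dr}(\alpha|_D)\le\mathrm{dr}(\alpha)$ and $\mathrm{dr}^c(\alpha|_D)\le\mathrm{dr}^c(\alpha)$. 4. Let $(A_n,\iota_n)_{n\in\mathbb{N}}$ be a direct system of C*-algebras with connecting *-homomorphisms $\iota_n:A_n\to A_{n+1}$, let $\alpha^{(n)}$ be actions of $G$ on $A_n$ with $\iota_n\circ\alpha^{(n)}_g=\alpha^{(n+1)}_g\circ\iota_n$ for all $n$ and $g$, and let $\alpha^{(\infty)}$ be the induced action on the C*-algebraic inductive limit $\varinjlim (A_n,\iota_n)$. Then $\mathrm{dr}(\alpha^{(\infty)})\le\liminf_{n}\mathrm{dr}(\alpha^{(n)})$ and $\mathrm{dr}^c(\alpha^{(\infty)})\le\liminf_{n}\mathrm{dr}^c(\alpha^{(n)})$.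 -/

import Mathlib

open scoped ENNReal TensorProduct CStarAlgebra

noncomputable section

/-! ### Closed ideals and quotients of C⋆-algebras -/

/-- A closed two-sided ideal of a C⋆-algebra. -/
structure ClosedIdeal (A : Type*) [NonUnitalCStarAlgebra A] extends Submodule ℂ A where
  mul_mem_left' : ∀ (a : A) {x : A}, x ∈ carrier → a * x ∈ carrier
  mul_mem_right' : ∀ (a : A) {x : A}, x ∈ carrier → x * a ∈ carrier
  isClosed' : IsClosed carrier

namespace ClosedIdeal

variable {A : Type*} [NonUnitalCStarAlgebra A]

instance : Membership A (ClosedIdeal A) := ⟨fun I x => x ∈ I.toSubmodule⟩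

theorem mul_mem_left (I : ClosedIdeal A) (a : A) {x : A} (hx : x ∈ I.toSubmodule) :
    a * x ∈ I.toSubmodule := I.mul_mem_left' a hx

theorem mul_mem_right (I : ClosedIdeal A) (a : A) {x : A} (hx : x ∈ I.toSubmodule) :
    x * a ∈ I.toSubmodule := I.mul_mem_right' a hx

instance isClosed (I : ClosedIdeal A) : IsClosed (I.toSubmodule : Set A) := I.isClosed'

/-- The C⋆-subalgebra `I ∩ I⋆`; it is all of `I`, by `star_mem`. -/
def starPart (I : ClosedIdeal A) : NonUnitalStarSubalgebra ℂ A where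
  carrier := {x | x ∈ I.toSubmodule ∧ star x ∈ I.toSubmodule}
  add_mem' hx hy := ⟨add_mem hx.1 hy.1, by rw [star_add]; exact add_mem hx.2 hy.2⟩
  zero_mem' := ⟨zero_mem _, by rw [star_zero]; exact zero_mem _⟩
  mul_mem' hx hy := ⟨I.mul_mem_left _ hy.1, by rw [star_mul]; exact I.mul_mem_left _ hx.2⟩
  smul_mem' c x hx :=
    ⟨Submodule.smul_mem _ c hx.1, by rw [star_smul]; exact Submodule.smul_mem _ _ hx.2⟩
  star_mem' hx := ⟨hx.2, by rw [star_star]; exact hx.1⟩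

instance (I : ClosedIdeal A) : IsClosed (I.starPart : Set A) :=
  I.isClosed.inter (I.isClosed.preimage continuous_star)

/-- Local approximate units of `I ∩ I⋆`, consisting of positive contractions. -/
theorem exists_approx (I : ClosedIdeal A) {i : A} (hi : i ∈ I.starPart) {ε : ℝ} (hε : 0 < ε) :
    ∃ c e : A, e = star c * c ∧ ‖e‖ ≤ 1 ∧ e ∈ I.toSubmodule ∧ ‖i - i * e‖ < ε := by
  let _ := CStarAlgebra.spectralOrder I.starPart
  have := CStarAlgebra.spectralOrderedRing I.starPart
  have h := CStarAlgebra.increasingApproximateUnit I.starPart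
  have h1 := (h.tendsto_mul_left (⟨i, hi⟩ : I.starPart)).eventually (Metric.ball_mem_nhds _ hε)
  obtain ⟨e, ⟨he1, he2⟩, he3⟩ := ((h.eventually_nonneg.and h.eventually_norm).and h1).exists
  obtain ⟨c, hc⟩ := CStarAlgebra.nonneg_iff_eq_star_mul_self.mp he1
  refine ⟨c, e, by rw [hc]; rfl, he2, e.2.1, ?_⟩
  have he4 : dist ((⟨i, hi⟩ : I.starPart) * e) ⟨i, hi⟩ < ε := he3
  rw [dist_comm, dist_eq_norm] at he4
  exact he4

theorem star_mem (I : ClosedIdeal A) {i : A} (hi : i ∈ I.toSubmodule) :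
    star i ∈ I.toSubmodule := by
  have hj : i * star i ∈ I.starPart :=
    ⟨I.mul_mem_right _ hi, by rw [star_mul, star_star]; exact I.mul_mem_right _ hi⟩
  have hcl := I.isClosed
  rw [← SetLike.mem_coe, ← hcl.closure_eq, Metric.mem_closure_iff]
  intro ε hε
  obtain ⟨c, e, hec, he1, heI, hlt⟩ := I.exists_approx hj (ε := ε ^ 2 / 2) (by positivity)
  refine ⟨star i * e, I.mul_mem_left _ heI, ?_⟩
  have hes : star e = e := by rw [hec]; simp
  rw [dist_eq_norm]
  set y := star i - star i * e with hy
  have h1 : star y * y = (i * star i - i * star i * e) - e * (i * star i - i * star i * e) := by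
    rw [hy]; simp only [star_sub, star_star, star_mul, hes]; noncomm_ring
  have h2 : ‖y‖ * ‖y‖ < ε ^ 2 := by
    rw [← CStarRing.norm_star_mul_self, h1]
    calc _ ≤ ‖i * star i - i * star i * e‖ + ‖e * (i * star i - i * star i * e)‖ := norm_sub_le _ _
      _ ≤ ‖i * star i - i * star i * e‖ + 1 * ‖i * star i - i * star i * e‖ := by
          gcongr
          exact (norm_mul_le _ _).trans (by gcongr)
      _ < ε ^ 2 := by linarith
  exact lt_of_pow_lt_pow_left₀ 2 hε.le (by rw [pow_two]; exact h2)

theorem mem_starPart (I : ClosedIdeal A) {i : A} (hi : i ∈ I.toSubmodule) : i ∈ I.starPart :=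
  ⟨hi, I.star_mem hi⟩

/-- The quotient C⋆-algebra `A / I`, with the quotient norm. -/
def Quot (I : ClosedIdeal A) : Type _ := A ⧸ I.toSubmodule

variable (I : ClosedIdeal A)

instance : NormedAddCommGroup I.Quot := inferInstanceAs (NormedAddCommGroup (A ⧸ I.toSubmodule))

instance : NormedSpace ℂ I.Quot := inferInstanceAs (NormedSpace ℂ (A ⧸ I.toSubmodule))

instance : CompleteSpace I.Quot := inferInstanceAs (CompleteSpace (A ⧸ I.toSubmodule))

/-- The quotient map. -/
def mkₗ : A →ₗ[ℂ] I.Quot := I.toSubmodule.mkQ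

theorem mkₗ_surjective : Function.Surjective I.mkₗ := I.toSubmodule.mkQ_surjective

theorem mkₗ_eq_iff {x y : A} : I.mkₗ x = I.mkₗ y ↔ x - y ∈ I.toSubmodule :=
  Submodule.Quotient.eq _

theorem norm_mkₗ_le (x : A) : ‖I.mkₗ x‖ ≤ ‖x‖ := Submodule.Quotient.norm_mk_le _ x

theorem exists_lift_norm_lt (x : I.Quot) {ε : ℝ} (hε : 0 < ε) :
    ∃ a : A, I.mkₗ a = x ∧ ‖a‖ < ‖x‖ + ε :=
  Submodule.Quotient.norm_mk_lt (S := I.toSubmodule) x hε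

instance : Mul I.Quot :=
  ⟨Quotient.map₂ (· * ·) (by
    intro a₁ b₁ h₁ a₂ b₂ h₂
    have h₁' : a₁ - b₁ ∈ I.toSubmodule := (Submodule.quotientRel_def _).mp h₁
    have h₂' : a₂ - b₂ ∈ I.toSubmodule := (Submodule.quotientRel_def _).mp h₂
    refine (Submodule.quotientRel_def _).mpr ?_
    have : a₁ * a₂ - b₁ * b₂ = (a₁ - b₁) * a₂ + b₁ * (a₂ - b₂) := by noncomm_ring
    rw [this]
    exact add_mem (I.mul_mem_right _ h₁') (I.mul_mem_left _ h₂'))⟩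

instance : Star I.Quot :=
  ⟨Quotient.map star (by
    intro a b h
    have h' : a - b ∈ I.toSubmodule := (Submodule.quotientRel_def _).mp h
    refine (Submodule.quotientRel_def _).mpr ?_
    rw [← star_sub]
    exact I.star_mem h')⟩

theorem mkₗ_mul (x y : A) : I.mkₗ (x * y) = I.mkₗ x * I.mkₗ y := rfl

theorem mkₗ_star (x : A) : I.mkₗ (star x) = star (I.mkₗ x) := rfl

instance : NonUnitalRing I.Quot :=
  { (inferInstance : AddCommGroup I.Quot), (inferInstance : Mul I.Quot) with
    left_distrib := by
      intro x y z
      obtain ⟨x, rfl⟩ := I.mkₗ_surjective x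
      obtain ⟨y, rfl⟩ := I.mkₗ_surjective y
      obtain ⟨z, rfl⟩ := I.mkₗ_surjective z
      simp only [← map_add, ← mkₗ_mul, mul_add]
    right_distrib := by
      intro x y z
      obtain ⟨x, rfl⟩ := I.mkₗ_surjective x
      obtain ⟨y, rfl⟩ := I.mkₗ_surjective y
      obtain ⟨z, rfl⟩ := I.mkₗ_surjective z
      simp only [← map_add, ← mkₗ_mul, add_mul]
    zero_mul := by
      intro x
      obtain ⟨x, rfl⟩ := I.mkₗ_surjective x
      rw [← map_zero I.mkₗ, ← mkₗ_mul, zero_mul]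
    mul_zero := by
      intro x
      obtain ⟨x, rfl⟩ := I.mkₗ_surjective x
      rw [← map_zero I.mkₗ, ← mkₗ_mul, mul_zero]
    mul_assoc := by
      intro x y z
      obtain ⟨x, rfl⟩ := I.mkₗ_surjective x
      obtain ⟨y, rfl⟩ := I.mkₗ_surjective y
      obtain ⟨z, rfl⟩ := I.mkₗ_surjective z
      simp only [← mkₗ_mul, mul_assoc] }

instance : NonUnitalNormedRing I.Quot :=
  { (inferInstance : NormedAddCommGroup I.Quot), (inferInstance : NonUnitalRing I.Quot) with
    norm_mul_le := by
      intro x y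
      have key : ∀ ε : ℝ, 0 < ε → ‖x * y‖ ≤ (‖x‖ + ε) * (‖y‖ + ε) := by
        intro ε hε
        obtain ⟨a, rfl, ha⟩ := I.exists_lift_norm_lt x hε
        obtain ⟨b, rfl, hb⟩ := I.exists_lift_norm_lt y hε
        rw [← mkₗ_mul]
        refine (I.norm_mkₗ_le _).trans ((norm_mul_le a b).trans ?_)
        gcongr
      have hc : Filter.Tendsto (fun ε : ℝ => (‖x‖ + ε) * (‖y‖ + ε)) (nhdsWithin 0 (Set.Ioi 0))
          (nhds ((‖x‖ + 0) * (‖y‖ + 0))) := by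
        apply tendsto_nhdsWithin_of_tendsto_nhds
        exact Continuous.tendsto (by fun_prop) 0
      have := ge_of_tendsto hc (by filter_upwards [self_mem_nhdsWithin] with ε hε using key ε hε)
      simpa using this }

instance : StarRing I.Quot where
  star_involutive x := by
    obtain ⟨x, rfl⟩ := I.mkₗ_surjective x
    rw [← mkₗ_star, ← mkₗ_star, star_star]
  star_mul x y := by
    obtain ⟨x, rfl⟩ := I.mkₗ_surjective x
    obtain ⟨y, rfl⟩ := I.mkₗ_surjective y
    simp only [← mkₗ_mul, ← mkₗ_star, star_mul]
  star_add x y := by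
    obtain ⟨x, rfl⟩ := I.mkₗ_surjective x
    obtain ⟨y, rfl⟩ := I.mkₗ_surjective y
    simp only [← map_add, ← mkₗ_star, star_add]

/-- If `e` is a positive contraction then `x ↦ (1 - e) x (1 - e)` is contractive. -/
theorem norm_compress_le {c e : A} (hec : e = star c * c) (he : ‖e‖ ≤ 1) (x : A) :
    ‖x - x * e - e * x + e * x * e‖ ≤ ‖x‖ := by
  let _ := CStarAlgebra.spectralOrder (Unitization ℂ A)
  have := CStarAlgebra.spectralOrderedRing (Unitization ℂ A)
  have h0 : (0 : Unitization ℂ A) ≤ (e : Unitization ℂ A) := by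
    rw [hec, Unitization.inr_mul, Unitization.inr_star]
    exact star_mul_self_nonneg _
  have h1 : (e : Unitization ℂ A) ≤ 1 := by
    rw [← CStarAlgebra.norm_le_one_iff_of_nonneg _ h0, Unitization.norm_inr]
    exact he
  have h2 : ‖(1 : Unitization ℂ A) - e‖ ≤ 1 := by
    rw [CStarAlgebra.norm_le_one_iff_of_nonneg _ (sub_nonneg.mpr h1)]
    exact sub_le_self _ h0
  have h3 : ((x - x * e - e * x + e * x * e : A) : Unitization ℂ A)
      = (1 - (e : Unitization ℂ A)) * x * (1 - e) := by
    simp only [Unitization.inr_add, Unitization.inr_sub, Unitization.inr_mul]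
    noncomm_ring
  rw [← Unitization.norm_inr (𝕜 := ℂ), h3, ← Unitization.norm_inr (𝕜 := ℂ) (a := x)]
  calc _ ≤ ‖(1 : Unitization ℂ A) - e‖ * ‖(x : Unitization ℂ A)‖ * ‖(1 : Unitization ℂ A) - e‖ :=
        (norm_mul_le _ _).trans (by gcongr; exact norm_mul_le _ _)
    _ ≤ 1 * ‖(x : Unitization ℂ A)‖ * 1 := by gcongr
    _ = _ := by ring

instance : CStarRing I.Quot where
  norm_mul_self_le x := by
    obtain ⟨a, rfl⟩ := I.mkₗ_surjective x
    rw [← mkₗ_star, ← mkₗ_mul]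
    refine le_of_forall_pos_le_add fun ε hε => ?_
    obtain ⟨b, hb, hbn⟩ := I.exists_lift_norm_lt (I.mkₗ (star a * a)) (half_pos hε)
    have hi : b - star a * a ∈ I.starPart := I.mem_starPart (I.mkₗ_eq_iff.mp hb)
    obtain ⟨c, e, hec, he1, heI, hlt⟩ := I.exists_approx hi (ε := ε / 4) (by positivity)
    have hes : star e = e := by rw [hec]; simp
    have hy : I.mkₗ a = I.mkₗ (a - a * e) := by
      rw [I.mkₗ_eq_iff, sub_sub_cancel]
      exact I.mul_mem_left _ heI
    set i := b - star a * a with hi'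
    have h1 : star (a - a * e) * (a - a * e)
        = (b - b * e - e * b + e * b * e) - ((i - i * e) - e * (i - i * e)) := by
      rw [hi']; simp only [star_sub, star_mul, hes]; noncomm_ring
    have h2 : ‖a - a * e‖ * ‖a - a * e‖ ≤ ‖b‖ + ε / 2 := by
      rw [← CStarRing.norm_star_mul_self, h1]
      calc _ ≤ ‖b - b * e - e * b + e * b * e‖ + ‖(i - i * e) - e * (i - i * e)‖ := norm_sub_le _ _
        _ ≤ ‖b‖ + (‖i - i * e‖ + 1 * ‖i - i * e‖) := by
            gcongr
            · exact norm_compress_le hec he1 b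
            · refine (norm_sub_le _ _).trans ?_
              gcongr
              exact (norm_mul_le _ _).trans (by gcongr)
        _ ≤ _ := by linarith
    rw [hy]
    have h3 := I.norm_mkₗ_le (a - a * e)
    calc _ ≤ ‖a - a * e‖ * ‖a - a * e‖ := by gcongr
      _ ≤ _ := by linarith

instance : NonUnitalCStarAlgebra I.Quot where
  smul_assoc c x y := by
    obtain ⟨x, rfl⟩ := I.mkₗ_surjective x
    obtain ⟨y, rfl⟩ := I.mkₗ_surjective y
    simp only [smul_eq_mul, ← mkₗ_mul, ← map_smul, smul_mul_assoc]
  smul_comm c x y := by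
    obtain ⟨x, rfl⟩ := I.mkₗ_surjective x
    obtain ⟨y, rfl⟩ := I.mkₗ_surjective y
    simp only [smul_eq_mul, ← mkₗ_mul, ← map_smul, mul_smul_comm]
  star_smul c x := by
    obtain ⟨x, rfl⟩ := I.mkₗ_surjective x
    simp only [← mkₗ_star, ← map_smul, star_smul]

/-- The quotient map as a ⋆-homomorphism. -/
def proj : A →⋆ₙₐ[ℂ] I.Quot where
  toFun := I.mkₗ
  map_smul' := map_smul I.mkₗ
  map_zero' := map_zero I.mkₗ
  map_add' := map_add I.mkₗ
  map_mul' := I.mkₗ_mul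
  map_star' := I.mkₗ_star

theorem proj_surjective : Function.Surjective I.proj := I.mkₗ_surjective

/-- A ⋆-homomorphism mapping `I` into itself induces one on `A / I`. -/
def quotMap (f : A →⋆ₙₐ[ℂ] A) (hf : ∀ x ∈ I, f x ∈ I) : I.Quot →⋆ₙₐ[ℂ] I.Quot :=
  let F : I.Quot →ₗ[ℂ] I.Quot :=
    I.toSubmodule.mapQ I.toSubmodule
      { toFun := f, map_add' := map_add f, map_smul' := map_smul f } hf
  have hF : ∀ x, F (I.mkₗ x) = I.mkₗ (f x) := fun _ => rfl
  { toFun := F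
    map_smul' := map_smul F
    map_zero' := map_zero F
    map_add' := map_add F
    map_mul' := by
      intro x y
      obtain ⟨x, rfl⟩ := I.mkₗ_surjective x
      obtain ⟨y, rfl⟩ := I.mkₗ_surjective y
      rw [← mkₗ_mul, hF, hF, hF, ← mkₗ_mul, map_mul]
    map_star' := by
      intro x
      obtain ⟨x, rfl⟩ := I.mkₗ_surjective x
      rw [← mkₗ_star, hF, hF, ← mkₗ_star, map_star] }

@[simp] theorem quotMap_proj (f : A →⋆ₙₐ[ℂ] A) (hf : ∀ x ∈ I, f x ∈ I) (x : A) :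
    I.quotMap f hf (I.proj x) = I.proj (f x) := rfl

end ClosedIdeal

/-! ### Group actions on C⋆-algebras -/

/-- An action of the discrete group `G` on the C⋆-algebra `A` by ⋆-automorphisms. -/
abbrev CStarAction (G : Type*) [Group G] (A : Type*) [NonUnitalCStarAlgebra A] :=
  G →* (A ≃⋆ₐ[ℂ] A)

namespace CStarAction

variable {G : Type*} [Group G] {A : Type*} [NonUnitalCStarAlgebra A]

/-- An action from a family of ⋆-endomorphisms `f g` with `f 1 = id` and `f (g h) = f g ∘ f h`. -/
def ofEnd (f : G → (A →⋆ₙₐ[ℂ] A)) (h1 : ∀ x, f 1 x = x)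
    (hmul : ∀ g h x, f (g * h) x = f g (f h x)) : CStarAction G A where
  toFun g := StarAlgEquiv.ofNonUnitalStarAlgHom (f g) (f g⁻¹)
    (by ext x; simp [← hmul, h1]) (by ext x; simp [← hmul, h1])
  map_one' := by ext x; exact h1 x
  map_mul' g h := by ext x; exact hmul g h x

@[simp] theorem ofEnd_apply (f : G → (A →⋆ₙₐ[ℂ] A)) (h1 : ∀ x, f 1 x = x)
    (hmul : ∀ g h x, f (g * h) x = f g (f h x)) (g : G) (x : A) :
    ofEnd f h1 hmul g x = f g x := rfl

/-- The action induced on the quotient by an invariant ideal. -/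
def quotient (α : CStarAction G A) (I : ClosedIdeal A) (hI : ∀ g, ∀ x ∈ I, α g x ∈ I) :
    CStarAction G I.Quot :=
  ofEnd (fun g => I.quotMap (α g).toNonUnitalStarAlgHom (hI g))
    (by
      intro x
      obtain ⟨x, rfl⟩ := I.proj_surjective x
      simp)
    (by
      intro g h x
      obtain ⟨x, rfl⟩ := I.proj_surjective x
      change I.proj (α (g * h) x) = I.proj (α g (α h x))
      rw [map_mul, StarAlgEquiv.mul_apply])

/-- The action induced on an invariant C⋆-subalgebra. -/
def restrict (α : CStarAction G A) (D : NonUnitalStarSubalgebra ℂ A) [IsClosed (D : Set A)]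
    (hD : ∀ g, ∀ x ∈ D, α g x ∈ D) : CStarAction G D :=
  ofEnd (fun g =>
      { toFun := fun x => ⟨α g x, hD g x x.2⟩
        map_smul' := fun c x => Subtype.ext (map_smul (α g) c (x : A))
        map_zero' := Subtype.ext (map_zero (α g))
        map_add' := fun x y => Subtype.ext (map_add (α g) (x : A) y)
        map_mul' := fun x y => Subtype.ext (map_mul (α g) (x : A) y)
        map_star' := fun x => Subtype.ext (map_star (α g) (x : A)) })
    (by intro x; apply Subtype.ext; simp)
    (by intro g h x; apply Subtype.ext; simp)

end CStarAction

/-! ### Sequence algebras and relative central sequence algebras -/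

section Sequences

variable (A : Type*) [NonUnitalCStarAlgebra A]

/-- The C⋆-algebra `ℓ^∞(ℕ, A)` of bounded sequences. -/
abbrev BddSeq := lp (fun _ : ℕ => A) ∞

/-- The ideal `c₀(ℕ, A)` of sequences converging to zero. -/
def c0Ideal : ClosedIdeal (BddSeq A) where
  carrier := {x | Filter.Tendsto (fun n => ‖x n‖) Filter.atTop (nhds 0)}
  add_mem' {x y} hx hy := by
    refine squeeze_zero (fun n => norm_nonneg _) (fun n => norm_add_le (x n) (y n)) ?_
    simpa using Filter.Tendsto.add hx hy
  zero_mem' := by simp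
  smul_mem' c x hx := by
    have : Filter.Tendsto (fun n => ‖c‖ * ‖x n‖) Filter.atTop (nhds (‖c‖ * 0)) :=
      Filter.Tendsto.const_mul _ hx
    simpa [norm_smul] using this
  mul_mem_left' a x hx := by
    refine squeeze_zero (g := fun n => ‖a‖ * ‖x n‖) (fun n => norm_nonneg _) (fun n => ?_) ?_
    · refine (norm_mul_le (a n) (x n)).trans ?_
      gcongr
      exact lp.norm_apply_le_norm ENNReal.top_ne_zero a n
    · simpa using Filter.Tendsto.const_mul ‖a‖ hx
  mul_mem_right' a x hx := by
    refine squeeze_zero (g := fun n => ‖x n‖ * ‖a‖) (fun n => norm_nonneg _) (fun n => ?_) ?_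
    · refine (norm_mul_le (x n) (a n)).trans ?_
      gcongr
      exact lp.norm_apply_le_norm ENNReal.top_ne_zero a n
    · simpa using Filter.Tendsto.mul_const ‖a‖ hx
  isClosed' := by
    refine isClosed_of_closure_subset fun x hx => ?_
    rw [Metric.mem_closure_iff] at hx
    change Filter.Tendsto _ _ _
    rw [Metric.tendsto_atTop]
    intro ε hε
    obtain ⟨y, hy, hxy⟩ := hx (ε / 2) (half_pos hε)
    obtain ⟨N, hN⟩ := Metric.tendsto_atTop.mp hy (ε / 2) (half_pos hε)
    refine ⟨N, fun n hn => ?_⟩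
    have h1 := hN n hn
    have h2 : ‖(x - y) n‖ ≤ ‖x - y‖ := lp.norm_apply_le_norm ENNReal.top_ne_zero (x - y) n
    rw [dist_eq_norm] at hxy
    simp only [dist_zero_right, norm_norm] at h1 ⊢
    have h3 : ‖x n‖ ≤ ‖(x - y) n‖ + ‖y n‖ := by
      have : x n = (x - y) n + y n := by simp
      calc ‖x n‖ = ‖(x - y) n + y n‖ := by rw [← this]
        _ ≤ _ := norm_add_le _ _
    linarith

/-- The sequence algebra `A_∞ = ℓ^∞(ℕ, A) / c₀(ℕ, A)`. -/
abbrev SeqAlg := (c0Ideal A).Quot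

variable {A}

/-- The embedding of `A` into `A_∞` by constant sequences. -/
def constSeq : A →⋆ₙₐ[ℂ] SeqAlg A :=
  (c0Ideal A).proj.comp
    { toFun := fun a => ⟨fun _ => a, memℓp_infty ⟨‖a‖, by rintro _ ⟨_, rfl⟩; exact le_rfl⟩⟩
      map_smul' := fun _ _ => rfl
      map_zero' := rfl
      map_add' := fun _ _ => rfl
      map_mul' := fun _ _ => rfl
      map_star' := fun _ => rfl }

/-- The relative commutant `A_∞ ∩ D'`. -/
def relCommutant (D : NonUnitalStarSubalgebra ℂ A) : NonUnitalStarSubalgebra ℂ (SeqAlg A) where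
  carrier := {x | ∀ d ∈ D, x * constSeq d = constSeq d * x}
  add_mem' hx hy d hd := by rw [add_mul, mul_add, hx d hd, hy d hd]
  zero_mem' d hd := by rw [zero_mul, mul_zero]
  mul_mem' hx hy d hd := by rw [mul_assoc, hy d hd, ← mul_assoc, hx d hd, mul_assoc]
  smul_mem' c x hx d hd := by rw [smul_mul_assoc, mul_smul_comm, hx d hd]
  star_mem' {x} hx d hd := by
    have := congrArg star (hx (star d) (star_mem hd))
    rw [star_mul, star_mul, ← map_star, star_star] at this
    exact this.symm

instance (D : NonUnitalStarSubalgebra ℂ A) : IsClosed (relCommutant D : Set (SeqAlg A)) := by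
  have : (relCommutant D : Set (SeqAlg A))
      = ⋂ d ∈ D, {x | x * constSeq d = constSeq d * x} := by
    ext x
    simp only [Set.mem_iInter]
    exact Iff.rfl
  rw [this]
  exact isClosed_biInter fun d _ => isClosed_eq (by fun_prop) (by fun_prop)

/-- The annihilator `Ann(D, A_∞)`, an ideal of `A_∞ ∩ D'`. -/
def annIdeal (D : NonUnitalStarSubalgebra ℂ A) : ClosedIdeal (relCommutant D) where
  carrier := {x | ∀ d ∈ D, (x : SeqAlg A) * constSeq d = 0 ∧ constSeq d * (x : SeqAlg A) = 0}
  add_mem' {x y} hx hy d hd := by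
    constructor
    · change ((x : SeqAlg A) + y) * _ = 0
      rw [add_mul, (hx d hd).1, (hy d hd).1, add_zero]
    · change _ * ((x : SeqAlg A) + y) = 0
      rw [mul_add, (hx d hd).2, (hy d hd).2, add_zero]
  zero_mem' d hd := ⟨zero_mul _, mul_zero _⟩
  smul_mem' c x hx d hd := by
    constructor
    · change (c • (x : SeqAlg A)) * _ = 0
      rw [smul_mul_assoc, (hx d hd).1, smul_zero]
    · change _ * (c • (x : SeqAlg A)) = 0
      rw [mul_smul_comm, (hx d hd).2, smul_zero]
  mul_mem_left' a x hx d hd := by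
    constructor
    · change ((a : SeqAlg A) * x) * _ = 0
      rw [mul_assoc, (hx d hd).1, mul_zero]
    · change _ * ((a : SeqAlg A) * x) = 0
      rw [← mul_assoc, ← a.2 d hd, mul_assoc, (hx d hd).2, mul_zero]
  mul_mem_right' a x hx d hd := by
    constructor
    · change ((x : SeqAlg A) * a) * _ = 0
      rw [mul_assoc, a.2 d hd, ← mul_assoc, (hx d hd).1, zero_mul]
    · change _ * ((x : SeqAlg A) * a) = 0
      rw [← mul_assoc, (hx d hd).2, zero_mul]
  isClosed' := by
    have : {x : relCommutant D |
          ∀ d ∈ D, (x : SeqAlg A) * constSeq d = 0 ∧ constSeq d * (x : SeqAlg A) = 0}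
        = ⋂ d ∈ D, ({x : relCommutant D | (x : SeqAlg A) * constSeq d = 0} ∩
            {x : relCommutant D | constSeq d * (x : SeqAlg A) = 0}) := by
      ext x
      simp only [Set.mem_iInter]
      exact Iff.rfl
    change IsClosed {x : relCommutant D |
          ∀ d ∈ D, (x : SeqAlg A) * constSeq d = 0 ∧ constSeq d * (x : SeqAlg A) = 0}
    rw [this]
    exact isClosed_biInter fun d _ =>
      (isClosed_eq (by fun_prop) (by fun_prop)).inter (isClosed_eq (by fun_prop) (by fun_prop))

/-- Kirchberg's relative central sequence algebra `F(D, A) = (A_∞ ∩ D') / Ann(D, A_∞)`. -/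
abbrev CentralSeqAlg (D : NonUnitalStarSubalgebra ℂ A) := (annIdeal D).Quot

end Sequences

namespace CStarAction

variable {G : Type*} [Group G] {A : Type*} [NonUnitalCStarAlgebra A]

/-- The pointwise action on `ℓ^∞(ℕ, A)`. -/
def bddSeq (α : CStarAction G A) : CStarAction G (BddSeq A) :=
  ofEnd (fun g =>
      { toFun := fun x => ⟨fun n => α g (x n), memℓp_infty ⟨‖x‖, by
          rintro _ ⟨n, rfl⟩
          exact (NonUnitalStarAlgHom.norm_apply_le (α g) (x n)).trans
            (lp.norm_apply_le_norm ENNReal.top_ne_zero x n)⟩⟩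
        map_smul' := fun c x => lp.ext (funext fun n => map_smul (α g) c (x n))
        map_zero' := lp.ext (funext fun _ => map_zero (α g))
        map_add' := fun x y => lp.ext (funext fun n => map_add (α g) (x n) (y n))
        map_mul' := fun x y => lp.ext (funext fun n => map_mul (α g) (x n) (y n))
        map_star' := fun x => lp.ext (funext fun n => map_star (α g) (x n)) })
    (by intro x; apply lp.ext; funext n; simp)
    (by intro g h x; apply lp.ext; funext n; simp)

/-- The induced action `α_∞` on `A_∞`. -/
def seqAlg (α : CStarAction G A) : CStarAction G (SeqAlg A) :=
  α.bddSeq.quotient (c0Ideal A) (by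
    intro g x hx
    refine squeeze_zero (fun n => norm_nonneg _) (fun n => ?_) hx
    exact NonUnitalStarAlgHom.norm_apply_le (α g) (x n))

theorem seqAlg_constSeq (α : CStarAction G A) (g : G) (a : A) :
    α.seqAlg g (constSeq a) = constSeq (α g a) := rfl

theorem seqAlg_constSeq_inv (α : CStarAction G A) (g : G) (a : A) :
    α.seqAlg g (constSeq (α g⁻¹ a)) = constSeq a := by
  rw [seqAlg_constSeq, ← StarAlgEquiv.mul_apply, ← map_mul, mul_inv_cancel, map_one,
    StarAlgEquiv.one_apply]

/-- The restriction of `α_∞` to `A_∞ ∩ D'`, for an invariant subalgebra `D`. -/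
def relCommutant (α : CStarAction G A) (D : NonUnitalStarSubalgebra ℂ A)
    (hD : ∀ g, ∀ x ∈ D, α g x ∈ D) : CStarAction G (relCommutant D) :=
  α.seqAlg.restrict (_root_.relCommutant D) (by
    intro g x hx d hd
    rw [← α.seqAlg_constSeq_inv g d, ← map_mul, ← map_mul, hx _ (hD _ _ hd)])

/-- The induced action on `F(D, A)`, for an invariant subalgebra `D`. -/
def centralSeqAlg (α : CStarAction G A) (D : NonUnitalStarSubalgebra ℂ A)
    (hD : ∀ g, ∀ x ∈ D, α g x ∈ D) : CStarAction G (CentralSeqAlg D) :=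
  (α.relCommutant D hD).quotient (annIdeal D) (by
    intro g x hx d hd
    change α.seqAlg g (x : SeqAlg A) * _ = 0 ∧ _ * α.seqAlg g (x : SeqAlg A) = 0
    rw [← α.seqAlg_constSeq_inv g d, ← map_mul, ← map_mul, (hx _ (hD _ _ hd)).1,
      (hx _ (hD _ _ hd)).2, map_zero]
    exact ⟨rfl, rfl⟩)

end CStarAction

/-! ### Completely positive maps of order zero -/

section Maps

variable {A B : Type*} [NonUnitalCStarAlgebra A] [NonUnitalCStarAlgebra B]

/-- `φ` is completely positive, for the canonical orders of the C⋆-algebras `A` and `B`. -/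
def IsCompletelyPositive (φ : A →ₗ[ℂ] B) : Prop :=
  letI := CStarAlgebra.spectralOrder A
  letI := CStarAlgebra.spectralOrder B
  haveI := CStarAlgebra.spectralOrderedRing A
  haveI := CStarAlgebra.spectralOrderedRing B
  ∃ ψ : A →CP B, ψ.toLinearMap = φ

/-- Orthogonality: `a b = b a = a⋆ b = b⋆ a = 0`. -/
def CStarOrthogonal (a b : A) : Prop :=
  a * b = 0 ∧ b * a = 0 ∧ star a * b = 0 ∧ star b * a = 0

/-- Contractive completely positive maps of order zero. -/
structure IsCcpOrderZero (φ : A →ₗ[ℂ] B) : Prop where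
  completelyPositive : IsCompletelyPositive φ
  contractive : ∀ a, ‖φ a‖ ≤ ‖a‖
  orderZero : ∀ a b, CStarOrthogonal a b → CStarOrthogonal (φ a) (φ b)

/-- A subalgebra is hereditary if it contains every positive element lying below one of its
elements. -/
def IsHereditary (D : NonUnitalStarSubalgebra ℂ A) : Prop :=
  letI := CStarAlgebra.spectralOrder A
  ∀ a b : A, 0 ≤ a → a ≤ b → b ∈ D → a ∈ D

end Maps

/-! ### Rokhlin dimension -/

section Rokhlin

variable {G : Type*} [Group G] {A : Type*} [NonUnitalCStarAlgebra A]

attribute [local instance] Subgroup.fintypeQuotientOfFiniteIndex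

/-- The C⋆-algebra `C(G/H)` of functions on the finite set `G/H`. -/
abbrev CosetFun (H : Subgroup G) := G ⧸ H → ℂ

/-- The translation action on `C(G/H)`: `(σ_t f)(x) = f(t⁻¹ x)`. -/
def cosetShift (H : Subgroup G) (t : G) (f : CosetFun H) : CosetFun H := fun x => f (t⁻¹ • x)

/-- `φ 0, …, φ d : C(G/H) → F(D, A)` are equivariant c.c.p. order zero maps whose values at `1`
add up to the unit of `F(D, A)`. -/
structure IsRokhlinTower (α : CStarAction G A) (H : Subgroup G) [H.FiniteIndex]
    (D : NonUnitalStarSubalgebra ℂ A) (hD : ∀ g, ∀ x ∈ D, α g x ∈ D) (d : ℕ)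
    (φ : Fin (d + 1) → (CosetFun H →ₗ[ℂ] CentralSeqAlg D)) : Prop where
  ccp_orderZero : ∀ l, IsCcpOrderZero (φ l)
  equivariant : ∀ l t f, φ l (cosetShift H t f) = α.centralSeqAlg D hD t (φ l f)
  sum_isUnit : ∀ x : CentralSeqAlg D, (∑ l, φ l 1) * x = x ∧ x * (∑ l, φ l 1) = x

/-- The condition `dim_Rok(α, H) ≤ d`. -/
def RokhlinDimRelLE (α : CStarAction G A) (H : Subgroup G) [H.FiniteIndex] (d : ℕ) : Prop :=
  ∀ (D : NonUnitalStarSubalgebra ℂ A), IsClosed (D : Set A) →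
    TopologicalSpace.IsSeparable (D : Set A) → ∀ hD : ∀ g, ∀ x ∈ D, α g x ∈ D,
      ∃ φ : Fin (d + 1) → (CosetFun H →ₗ[ℂ] CentralSeqAlg D), IsRokhlinTower α H D hD d φ

/-- The condition `dim_Rok^c(α, H) ≤ d`, where the maps have pairwise commuting ranges. -/
def RokhlinDimCommRelLE (α : CStarAction G A) (H : Subgroup G) [H.FiniteIndex] (d : ℕ) : Prop :=
  ∀ (D : NonUnitalStarSubalgebra ℂ A), IsClosed (D : Set A) →
    TopologicalSpace.IsSeparable (D : Set A) → ∀ hD : ∀ g, ∀ x ∈ D, α g x ∈ D,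
      ∃ φ : Fin (d + 1) → (CosetFun H →ₗ[ℂ] CentralSeqAlg D), IsRokhlinTower α H D hD d φ ∧
        ∀ k l, k ≠ l → ∀ f₁ f₂, φ k f₁ * φ l f₂ = φ l f₂ * φ k f₁

/-- Rokhlin dimension relative to `H`: the least `d` as above, or `⊤` if there is none. -/
def rokhlinDimRel (α : CStarAction G A) (H : Subgroup G) [H.FiniteIndex] : ℕ∞ :=
  ⨅ (d : ℕ) (_ : RokhlinDimRelLE α H d), (d : ℕ∞)

/-- Rokhlin dimension with commuting towers relative to `H`. -/
def rokhlinDimCommRel (α : CStarAction G A) (H : Subgroup G) [H.FiniteIndex] : ℕ∞ :=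
  ⨅ (d : ℕ) (_ : RokhlinDimCommRelLE α H d), (d : ℕ∞)

/-- The Rokhlin dimension of an action. -/
def rokhlinDim (α : CStarAction G A) : ℕ∞ :=
  ⨆ (H : Subgroup G) (_ : H.FiniteIndex), rokhlinDimRel α H

/-- The Rokhlin dimension with commuting towers of an action. -/
def rokhlinDimComm (α : CStarAction G A) : ℕ∞ :=
  ⨆ (H : Subgroup G) (_ : H.FiniteIndex), rokhlinDimCommRel α H

end Rokhlin

/-! ### Amenability, tensor products, inductive limits -/

open scoped Pointwise symmDiff in
open scoped Classical in
/-- Amenability of a discrete group: for every finite `M ⊆ G` and `ε > 0` there is a finite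
nonempty `K ⊆ G` with `|sK ∆ K| ≤ ε |K|` for all `s ∈ M`. -/
def IsAmenableGroup (G : Type*) [Group G] : Prop :=
  ∀ (M : Finset G) (ε : ℝ), 0 < ε → ∃ K : Finset G, K.Nonempty ∧
    ∀ s ∈ M, (((s • K) ∆ K).card : ℝ) ≤ ε * K.card

/-- `j` exhibits the C⋆-algebra `C` as a completion of the algebraic tensor product `A ⊙ B` in a
C⋆-norm. -/
structure IsTensorCompletion {A B C : Type*} [NonUnitalCStarAlgebra A] [NonUnitalCStarAlgebra B]
    [NonUnitalCStarAlgebra C] (j : A ⊗[ℂ] B →⋆ₙₐ[ℂ] C) : Prop where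
  injective : Function.Injective j
  denseRange : DenseRange j

section Limits

variable {A : ℕ → Type*} [∀ n, NonUnitalCStarAlgebra (A n)]

/-- The composite connecting map `A n → A (n + k)` of a direct system. -/
def directSystemMap (ι : ∀ n, A n →⋆ₙₐ[ℂ] A (n + 1)) (n : ℕ) : ∀ k : ℕ, A n → A (n + k)
  | 0 => id
  | k + 1 => fun a => ι (n + k) (directSystemMap ι n k a)

/-- `(L, μ)` is the C⋆-algebraic inductive limit of the direct system `(A, ι)`: `L` is the
completion of the algebraic limit in the seminorm `‖μ n a‖ = lim_k ‖ι_{n, n+k} a‖`. -/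
structure IsCStarInductiveLimit {L : Type*} [NonUnitalCStarAlgebra L]
    (ι : ∀ n, A n →⋆ₙₐ[ℂ] A (n + 1)) (μ : ∀ n, A n →⋆ₙₐ[ℂ] L) : Prop where
  compatible : ∀ n a, μ (n + 1) (ι n a) = μ n a
  dense : Dense (⋃ n, Set.range (μ n))
  norm_eq : ∀ n a, Filter.Tendsto (fun k => ‖directSystemMap ι n k a‖) Filter.atTop (nhds ‖μ n a‖)

end Limits

end

/-! The strategy is to trade order zero maps into $F(D,A)$ for relations between finitely many
elements of $A_\infty$. Since $C(G/H)$ is finite-dimensional and commutative, a c.c.p. order zero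
map on it is determined by the positive contractions $\varphi_\ell(\delta_x)$. Their square roots
lift to self-adjoint contractions $c_{\ell,x}\in A_\infty\cap D'$. Passing to the quotient by
$\mathrm{Ann}(D,A_\infty)$ means that relations hold after multiplication by every $a\in D$: the
squares sum to a unit, are orthogonal within each colour, are permuted by $G$ and, for commuting
towers, commute across colours. Conversely, $f\mapsto\sum_x f(x)c_{\ell,x}^2$ recovers order zero
maps, positivity being automatic for squares.

Each relation is a bounded operator, its defect, applied to $a$. The elements killed by it form a
closed subspace, so separable $D$ may be replaced by countable sets $S$
(`rokhlinLE_iff_hasSeqTowers`). As $G$ is countable there are only countably many relations. A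
diagonal argument then shows that a tower exists for every countable set as soon as every finite set
of relations can be solved approximately in $A$ on every finite set (`HasSeqTowers.of_approx`).

The permanence properties become constructions with the $c_{\ell,x}$. Towers push forward along
equivariant homomorphisms; this gives quotients and, together with the approximate criterion,
inductive limits. For a hereditary subalgebra, $c$ is replaced by $ece$, where $e$ is a sequence of
contractions in $D$ acting as a unit on the orbit of $S$. For tensor products, $c$ is replaced by
$c\otimes e$, with $e$ a unit for the orbit of the second legs. An arbitrary C*-norm is handled by
proving that $(a,b)\mapsto a\otimes b$ is bounded (`IsStarBilinear.exists_bound`,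
`IsStarBilinear.norm_le_one`). -/

noncomputable section

/-! ### Lifting from quotients, maps between sequence algebras -/

namespace ClosedIdeal

variable {A B : Type*} [NonUnitalCStarAlgebra A] [NonUnitalCStarAlgebra B] (I : ClosedIdeal A)

theorem proj_eq_zero_iff {x : A} : I.proj x = 0 ↔ x ∈ I.toSubmodule := by
  rw [← map_zero I.proj]
  exact I.mkₗ_eq_iff.trans (by rw [sub_zero])

theorem norm_proj_le (x : A) : ‖I.proj x‖ ≤ ‖x‖ := I.norm_mkₗ_le x

/-- A ⋆-homomorphism vanishing on `I` factors through `A / I`. -/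
def lift (f : A →⋆ₙₐ[ℂ] B) (hf : ∀ x ∈ I.toSubmodule, f x = 0) : I.Quot →⋆ₙₐ[ℂ] B :=
  let F : I.Quot →ₗ[ℂ] B :=
    I.toSubmodule.liftQ { toFun := f, map_add' := map_add f, map_smul' := map_smul f } hf
  have hF : ∀ x, F (I.mkₗ x) = f x := fun _ => rfl
  { toFun := F
    map_smul' := map_smul F
    map_zero' := map_zero F
    map_add' := map_add F
    map_mul' := by
      intro x y
      obtain ⟨x, rfl⟩ := I.mkₗ_surjective x
      obtain ⟨y, rfl⟩ := I.mkₗ_surjective y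
      rw [← mkₗ_mul, hF, hF, hF, map_mul]
    map_star' := by
      intro x
      obtain ⟨x, rfl⟩ := I.mkₗ_surjective x
      rw [← mkₗ_star, hF, hF, map_star] }

/-- Self-adjoint contractions lift to self-adjoint contractions. -/
theorem exists_selfAdjoint_lift {q : I.Quot} (hq : IsSelfAdjoint q) (hq1 : ‖q‖ ≤ 1) :
    ∃ b : A, IsSelfAdjoint b ∧ ‖b‖ ≤ 1 ∧ I.proj b = q := by
  obtain ⟨a, rfl⟩ := I.proj_surjective q
  let b : A := (2⁻¹ : ℂ) • (a + star a)
  have hb : IsSelfAdjoint b := by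
    rw [IsSelfAdjoint, star_smul, star_add, star_star, add_comm]
    simp [b]
  have hpb : I.proj b = I.proj a := by
    have : star (I.proj a) = I.proj a := hq
    simp only [b, map_smul, map_add, map_star, this]
    rw [← two_smul ℂ, smul_smul]
    norm_num
  -- Truncating the spectrum to $[-1,1]$ makes the lift contractive. The functional calculus
  -- commutes with the quotient map, and truncation does nothing to the image, whose spectrum
  -- already lies in $[-1,1]$.
  let h : ℝ → ℝ := fun t => max (-1) (min 1 t)
  have hcont : Continuous h := by fun_prop
  have h0 : h 0 = 0 := by simp [h]
  refine ⟨cfcₙ h b, cfcₙ_predicate h b, norm_cfcₙ_le fun t _ => ?_, ?_⟩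
  · rw [Real.norm_eq_abs, abs_le]
    exact ⟨le_max_left _ _, max_le (by norm_num) (min_le_left _ _)⟩
  · have hproj : Continuous I.proj :=
      AddMonoidHomClass.continuous_of_bound I.proj 1 fun x => by
        rw [one_mul]; exact I.norm_proj_le x
    rw [NonUnitalStarAlgHom.map_cfcₙ I.proj h b hcont.continuousOn h0 hproj hb (hb.map I.proj), hpb]
    conv_rhs => rw [← cfcₙ_id ℝ (I.proj a) hq]
    refine cfcₙ_congr fun t ht => ?_
    have h1 := norm_apply_le_norm_cfcₙ (id : ℝ → ℝ) (I.proj a) ht continuousOn_id rfl hq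
    rw [cfcₙ_id ℝ (I.proj a) hq] at h1
    have h2 : |t| ≤ 1 := h1.trans hq1
    rw [abs_le] at h2
    simp only [h, id, min_eq_right h2.2, max_eq_right h2.1]

end ClosedIdeal

/-! ### Bounded sequences, functoriality of the sequence algebra, sequence units -/

section SeqTools

variable {A B : Type*} [NonUnitalCStarAlgebra A] [NonUnitalCStarAlgebra B]

/-- A bounded sequence as an element of `ℓ^∞(ℕ, A)`. -/
def BddSeq.mk (x : ℕ → A) (K : ℝ) (hx : ∀ n, ‖x n‖ ≤ K) : BddSeq A :=
  ⟨x, memℓp_infty ⟨K, by rintro _ ⟨n, rfl⟩; exact hx n⟩⟩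

theorem BddSeq.norm_apply_le (x : BddSeq A) (n : ℕ) : ‖x n‖ ≤ ‖x‖ :=
  lp.norm_apply_le_norm ENNReal.top_ne_zero x n

theorem BddSeq.norm_mk_le (x : ℕ → A) (K : ℝ) (hx : ∀ n, ‖x n‖ ≤ K) :
    ‖BddSeq.mk x K hx‖ ≤ K :=
  lp.norm_le_of_forall_le ((norm_nonneg _).trans (hx 0)) hx

/-- The constant sequences in `ℓ^∞(ℕ, A)`. -/
def BddSeq.const (a : A) : BddSeq A := BddSeq.mk (fun _ => a) ‖a‖ fun _ => le_rfl

theorem proj_const (a : A) : (c0Ideal A).proj (BddSeq.const a) = constSeq a := rfl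

theorem proj_seq_eq_zero_iff {x : BddSeq A} :
    (c0Ideal A).proj x = 0 ↔ Filter.Tendsto (fun n => ‖x n‖) Filter.atTop (nhds 0) :=
  (c0Ideal A).proj_eq_zero_iff

theorem proj_seq_eq_iff {x y : BddSeq A} :
    (c0Ideal A).proj x = (c0Ideal A).proj y ↔
      Filter.Tendsto (fun n => ‖x n - y n‖) Filter.atTop (nhds 0) := by
  rw [← sub_eq_zero, ← map_sub, proj_seq_eq_zero_iff]
  rfl

/-- The class has another representative of norm less than `ε`, and it differs from `x` by a null
sequence. -/
theorem eventually_norm_lt_of_norm_proj_lt {x : BddSeq A} {ε : ℝ}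
    (h : ‖(c0Ideal A).proj x‖ < ε) : ∀ᶠ n in Filter.atTop, ‖x n‖ < ε := by
  obtain ⟨y, hy, hyn⟩ := (c0Ideal A).exists_lift_norm_lt ((c0Ideal A).proj x) (sub_pos.mpr h)
  rw [add_sub_cancel] at hyn
  have h1 := proj_seq_eq_iff.mp (hy.symm : (c0Ideal A).proj x = (c0Ideal A).proj y)
  filter_upwards [h1.eventually_lt_const (sub_pos.mpr hyn)] with n hn
  have h2 : ‖x n‖ ≤ ‖x n - y n‖ + ‖y n‖ := by simpa using norm_add_le (x n - y n) (y n)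
  have h3 := BddSeq.norm_apply_le y n
  linarith

theorem norm_constSeq_le (a : A) : ‖(constSeq a : SeqAlg A)‖ ≤ ‖a‖ :=
  NonUnitalStarAlgHom.norm_apply_le constSeq a

theorem continuous_constSeq : Continuous (constSeq : A → SeqAlg A) :=
  AddMonoidHomClass.continuous_of_bound (constSeq (A := A)) 1 fun x => by
    rw [one_mul]; exact norm_constSeq_le x

/-- Evaluation of bounded sequences at `n`. -/
def BddSeq.eval (n : ℕ) : BddSeq A →⋆ₙₐ[ℂ] A where
  toFun x := x n
  map_smul' _ _ := rfl
  map_zero' := rfl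
  map_add' _ _ := rfl
  map_mul' _ _ := rfl
  map_star' _ := rfl

@[simp] theorem BddSeq.eval_apply (n : ℕ) (x : BddSeq A) : BddSeq.eval n x = x n := rfl

/-- Pointwise application of a ⋆-homomorphism to bounded sequences. -/
def BddSeq.map (f : A →⋆ₙₐ[ℂ] B) : BddSeq A →⋆ₙₐ[ℂ] BddSeq B where
  toFun x := BddSeq.mk (fun n => f (x n)) ‖x‖ fun n =>
    (NonUnitalStarAlgHom.norm_apply_le f (x n)).trans (BddSeq.norm_apply_le x n)
  map_smul' c x := lp.ext (funext fun n => map_smul f c (x n))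
  map_zero' := lp.ext (funext fun _ => map_zero f)
  map_add' x y := lp.ext (funext fun n => map_add f (x n) (y n))
  map_mul' x y := lp.ext (funext fun n => map_mul f (x n) (y n))
  map_star' x := lp.ext (funext fun n => map_star f (x n))

@[simp] theorem BddSeq.map_apply (f : A →⋆ₙₐ[ℂ] B) (x : BddSeq A) (n : ℕ) :
    BddSeq.map f x n = f (x n) := rfl

/-- The ⋆-homomorphism `A_∞ → B_∞` induced by a ⋆-homomorphism `A → B`. -/
def SeqAlg.map (f : A →⋆ₙₐ[ℂ] B) : SeqAlg A →⋆ₙₐ[ℂ] SeqAlg B :=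
  (c0Ideal A).lift ((c0Ideal B).proj.comp (BddSeq.map f)) fun x hx =>
    proj_seq_eq_zero_iff.mpr
      (squeeze_zero (fun _ => norm_nonneg _)
        (fun n => NonUnitalStarAlgHom.norm_apply_le f (x n)) hx)

@[simp] theorem SeqAlg.map_proj (f : A →⋆ₙₐ[ℂ] B) (x : BddSeq A) :
    SeqAlg.map f ((c0Ideal A).proj x) = (c0Ideal B).proj (BddSeq.map f x) := rfl

theorem SeqAlg.map_constSeq (f : A →⋆ₙₐ[ℂ] B) (a : A) :
    SeqAlg.map f (constSeq a) = constSeq (f a) := rfl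

theorem SeqAlg.map_injective (f : A →⋆ₙₐ[ℂ] B) (hf : ∀ a, ‖f a‖ = ‖a‖) :
    Function.Injective (SeqAlg.map f) := by
  intro x y hxy
  obtain ⟨x, rfl⟩ := (c0Ideal A).proj_surjective x
  obtain ⟨y, rfl⟩ := (c0Ideal A).proj_surjective y
  rw [SeqAlg.map_proj, SeqAlg.map_proj, proj_seq_eq_iff] at hxy
  rw [proj_seq_eq_iff]
  simpa only [BddSeq.map_apply, ← map_sub, hf] using hxy

theorem SeqAlg.map_seqAlg {G : Type*} [Group G] (α : CStarAction G A) (β : CStarAction G B)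
    (f : A →⋆ₙₐ[ℂ] B) (hf : ∀ g a, f (α g a) = β g (f a)) (g : G) (x : SeqAlg A) :
    SeqAlg.map f (α.seqAlg g x) = β.seqAlg g (SeqAlg.map f x) := by
  obtain ⟨x, rfl⟩ := (c0Ideal A).proj_surjective x
  refine congrArg (c0Ideal B).proj (lp.ext (funext fun n => hf g (x n)))

/-- A countable set has a self-adjoint contractive unit in the sequence algebra. -/
theorem exists_seq_unit {S : Set A} (hS : S.Countable) :
    ∃ e : BddSeq A, IsSelfAdjoint e ∧ ‖e‖ ≤ 1 ∧ ∀ a ∈ S,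
      (c0Ideal A).proj e * constSeq a = constSeq a ∧
        constSeq a * (c0Ideal A).proj e = constSeq a := by
  rcases S.eq_empty_or_nonempty with rfl | hne
  · exact ⟨0, .zero _, by simp, by simp⟩
  obtain ⟨s, rfl⟩ := hS.exists_eq_range hne
  let _ := CStarAlgebra.spectralOrder A
  have := CStarAlgebra.spectralOrderedRing A
  have h := CStarAlgebra.increasingApproximateUnit A
  -- Diagonal choice: the `n`-th entry comes from an approximate unit and serves the first `n + 1`
  -- elements up to `1 / (n + 1)`.
  have key : ∀ n : ℕ, ∃ e : A, IsSelfAdjoint e ∧ ‖e‖ ≤ 1 ∧ ∀ i ∈ Finset.range (n + 1),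
      ‖e * s i - s i‖ < 1 / (n + 1) ∧ ‖s i * e - s i‖ < 1 / (n + 1) := by
    intro n
    have hpos : (0 : ℝ) < 1 / (n + 1) := by positivity
    have h1 : ∀ᶠ e in CStarAlgebra.approximateUnit A, ∀ i ∈ Finset.range (n + 1),
        ‖e * s i - s i‖ < 1 / (n + 1) ∧ ‖s i * e - s i‖ < 1 / (n + 1) := by
      rw [Filter.eventually_all_finset]
      intro i _
      have h2 := (h.tendsto_mul_left (s i)).eventually (Metric.ball_mem_nhds _ hpos)
      have h3 := (h.tendsto_mul_right (s i)).eventually (Metric.ball_mem_nhds _ hpos)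
      simp only [dist_eq_norm] at h2 h3
      filter_upwards [h2, h3] with e he2 he3 using ⟨he3, he2⟩
    obtain ⟨e, ⟨he1, he2⟩, he3⟩ := ((h.eventually_nonneg.and h.eventually_norm).and h1).exists
    exact ⟨e, IsSelfAdjoint.of_nonneg he1, he2, he3⟩
  choose e he1 he2 he3 using key
  refine ⟨BddSeq.mk e 1 he2, lp.ext (funext fun n => he1 n), BddSeq.norm_mk_le _ _ _, ?_⟩
  rintro _ ⟨i, rfl⟩
  rw [← proj_const, ← map_mul, ← map_mul, proj_seq_eq_iff, proj_seq_eq_iff]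
  constructor
  · refine squeeze_zero' (.of_forall fun _ => norm_nonneg _) ?_
      tendsto_one_div_add_atTop_nhds_zero_nat
    filter_upwards [Filter.eventually_ge_atTop i] with n hn
    exact (he3 n i (Finset.mem_range.mpr (by omega))).1.le
  · refine squeeze_zero' (.of_forall fun _ => norm_nonneg _) ?_
      tendsto_one_div_add_atTop_nhds_zero_nat
    filter_upwards [Filter.eventually_ge_atTop i] with n hn
    exact (he3 n i (Finset.mem_range.mpr (by omega))).2.le

end SeqTools

/-! ### Rokhlin towers as families of self-adjoint contractions in the sequence algebra -/

section TowerRelations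

variable {G : Type*} [Group G]

attribute [local instance] Subgroup.fintypeQuotientOfFiniteIndex

/-- Index set of the relations imposed on a Rokhlin tower. The relations between different
colours are only present if `P` holds. -/
inductive TowerRel (P : Prop) (H : Subgroup G) (d : ℕ) : Type _
  | sum : TowerRel P H d
  | orth (l : Fin (d + 1)) (x y : G ⧸ H) (h : x ≠ y) : TowerRel P H d
  | equiv (g : G) (l : Fin (d + 1)) (x : G ⧸ H) : TowerRel P H d
  | central (l : Fin (d + 1)) (x : G ⧸ H) : TowerRel P H d
  | comm (k l : Fin (d + 1)) (x y : G ⧸ H) (hP : P) (h : k ≠ l) : TowerRel P H d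

variable {P : Prop} {H : Subgroup G} {d : ℕ}

/-- This allows one sequence to satisfy all relations asymptotically. The proof components of a
relation carry no data, so forgetting them is injective. -/
instance [Countable G] : Countable (TowerRel P H d) := by
  let e : TowerRel P H d → Unit ⊕ (Fin (d + 1) × (G ⧸ H) × (G ⧸ H)) ⊕
      (G × Fin (d + 1) × (G ⧸ H)) ⊕ (Fin (d + 1) × (G ⧸ H)) ⊕
      (Fin (d + 1) × Fin (d + 1) × (G ⧸ H) × (G ⧸ H)) := fun r => match r with
    | .sum => .inl ()
    | .orth l x y _ => .inr (.inl (l, x, y))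
    | .equiv g l x => .inr (.inr (.inl (g, l, x)))
    | .central l x => .inr (.inr (.inr (.inl (l, x))))
    | .comm k l x y _ _ => .inr (.inr (.inr (.inr (k, l, x, y))))
  have : Countable (G ⧸ H) := Quotient.countable
  refine Function.Injective.countable (f := e) fun r s h => ?_
  cases r <;> cases s <;> simp_all [e]

variable [H.FiniteIndex]

/-- The defect of the relation `r` for the family `c`, as an operator on the algebra. -/
def TowerRel.eval {X : Type*} [NonUnitalCStarAlgebra X] (α : CStarAction G X)
    (c : Fin (d + 1) → G ⧸ H → X) : TowerRel P H d → X →L[ℂ] X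
  | .sum => .mul ℂ X (∑ l, ∑ x, c l x * c l x) - .id ℂ X
  | .orth l x y _ => .mul ℂ X (c l x * c l x * (c l y * c l y))
  | .equiv g l x => .mul ℂ X (α g (c l x * c l x) - c l (g • x) * c l (g • x))
  -- Centrality is imposed on `c l x` itself rather than on its square, so that `c l x` lies in the
  -- relative commutant and can be moved past `a` in compressions.
  | .central l x => .mul ℂ X (c l x) - (ContinuousLinearMap.mul ℂ X).flip (c l x)
  | .comm k l x y _ _ => .mul ℂ X (c k x * c k x * (c l y * c l y) - c l y * c l y * (c k x * c k x))

namespace TowerRel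

variable {X Y : Type*} [NonUnitalCStarAlgebra X] [NonUnitalCStarAlgebra Y]

/-- Defects are built from products, linear combinations and the action only. This transports
relations between `A`, bounded sequences, sequence algebras and target algebras. -/
theorem map_eval {α : CStarAction G X} {β : CStarAction G Y} (f : X →⋆ₙₐ[ℂ] Y)
    (hf : ∀ g a, f (α g a) = β g (f a)) (c : Fin (d + 1) → G ⧸ H → X) (r : TowerRel P H d) (a : X) :
    f (r.eval α c a) = r.eval β (fun l x => f (c l x)) (f a) := by
  cases r <;> simp [eval, hf]

variable (H d) in
/-- A bound for the defects of a family of contractions. -/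
def evalBound : ℝ := (d + 1) * Fintype.card (G ⧸ H) + 2

/-- The sum of squares contributes at most `(d + 1) * |G/H|`; the extra `2` absorbs the subtracted
identity and the differences of two contractions. Uniformity in `r` and `c` is what makes perturbing
`a` harmless. -/
theorem norm_eval_le (α : CStarAction G X) {c : Fin (d + 1) → G ⧸ H → X}
    (hc : ∀ l x, ‖c l x‖ ≤ 1) (r : TowerRel P H d) (a : X) :
    ‖r.eval α c a‖ ≤ evalBound H d * ‖a‖ := by
  have hf : ∀ l x, ‖c l x * c l x‖ ≤ 1 := fun l x =>
    (norm_mul_le _ _).trans (mul_le_one₀ (hc l x) (norm_nonneg _) (hc l x))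
  have hff : ∀ k l x y, ‖c k x * c k x * (c l y * c l y)‖ ≤ 1 := fun k l x y =>
    (norm_mul_le _ _).trans (mul_le_one₀ (hf k x) (norm_nonneg _) (hf l y))
  have hsub : ∀ u v : X, ‖u‖ ≤ 1 → ‖v‖ ≤ 1 → ‖u - v‖ ≤ 2 := fun u v hu hv =>
    (norm_sub_le u v).trans (by linarith)
  have hN : (0 : ℝ) ≤ (d + 1) * Fintype.card (G ⧸ H) := by positivity
  have hmul : ∀ u : X, ‖u‖ ≤ 2 → ‖u * a‖ ≤ evalBound H d * ‖a‖ := fun u hu =>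
    (norm_mul_le _ _).trans (by gcongr; unfold evalBound; linarith)
  cases r with
  | sum =>
    have h1 : ‖∑ l, ∑ x, c l x * c l x‖ ≤ (d + 1) * Fintype.card (G ⧸ H) := by
      refine (norm_sum_le _ _).trans ((Finset.sum_le_sum fun l _ =>
        (norm_sum_le _ _).trans (Finset.sum_le_sum fun x _ => hf l x)).trans ?_)
      simp
    refine (norm_sub_le ((∑ l, ∑ x, c l x * c l x) * a) a).trans ?_
    have h2 := norm_mul_le (∑ l, ∑ x, c l x * c l x) a
    have h3 : ‖∑ l, ∑ x, c l x * c l x‖ * ‖a‖ ≤ (d + 1) * Fintype.card (G ⧸ H) * ‖a‖ := by gcongr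
    have h4 := norm_nonneg a
    unfold evalBound
    linarith
  | orth l x y h => exact hmul _ ((hff _ _ _ _).trans (by norm_num))
  | equiv g l x =>
    exact hmul _ (hsub _ _ ((NonUnitalStarAlgHom.norm_apply_le (α g) _).trans (hf l x)) (hf _ _))
  | central l x =>
    refine (norm_sub_le (c l x * a) (a * c l x)).trans ?_
    have h2 := norm_mul_le (c l x) a
    have h3 := norm_mul_le a (c l x)
    have h4 := norm_nonneg a
    have h5 := hc l x
    unfold evalBound
    nlinarith
  | comm k l x y hP h => exact hmul _ (hsub _ _ (hff _ _ _ _) (hff _ _ _ _))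

end TowerRel

variable {A B : Type*} [NonUnitalCStarAlgebra A] [NonUnitalCStarAlgebra B]

/-- The self-adjoint contractions `c l x` in `A_∞` form a Rokhlin tower relative to `S ⊆ A`. -/
structure IsSeqTower (P : Prop) (α : CStarAction G A) (S : Set A)
    (c : Fin (d + 1) → G ⧸ H → SeqAlg A) : Prop where
  isSelfAdjoint : ∀ l x, IsSelfAdjoint (c l x)
  norm_le_one : ∀ l x, ‖c l x‖ ≤ 1
  eval_eq_zero : ∀ (r : TowerRel P H d), ∀ a ∈ S, r.eval α.seqAlg c (constSeq a) = 0

/-- Every countable subset of `A` has a Rokhlin tower in `A_∞`. -/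
def HasSeqTowers (P : Prop) (α : CStarAction G A) (H : Subgroup G) [H.FiniteIndex] (d : ℕ) : Prop :=
  ∀ S : Set A, S.Countable → ∃ c : Fin (d + 1) → G ⧸ H → SeqAlg A, IsSeqTower P α S c

namespace IsSeqTower

variable {α : CStarAction G A} {β : CStarAction G B} {S : Set A}
  {c : Fin (d + 1) → G ⧸ H → SeqAlg A}

/-- A defect is linear and continuous in `a`, so its zero set is a closed subspace. -/
theorem closure_span (hc : IsSeqTower P α S c) :
    IsSeqTower P α (closure (Submodule.span ℂ S : Set A)) c where
  isSelfAdjoint := hc.isSelfAdjoint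
  norm_le_one := hc.norm_le_one
  eval_eq_zero r a ha := by
    have hcl : IsClosed {a : A | r.eval α.seqAlg c (constSeq a) = 0} :=
      isClosed_eq ((r.eval α.seqAlg c).continuous.comp continuous_constSeq) continuous_const
    refine closure_minimal (fun a ha => ?_) hcl ha
    induction ha using Submodule.span_induction with
    | mem a ha => exact hc.eval_eq_zero r a ha
    | zero => simp
    | add a b _ _ ha hb =>
      change r.eval α.seqAlg c (constSeq (a + b)) = 0
      rw [map_add, map_add, ha, hb, add_zero]
    | smul z a _ ha =>
      change r.eval α.seqAlg c (constSeq (z • a)) = 0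
      rw [map_smul, map_smul, ha, smul_zero]

theorem mono {T : Set A} (hc : IsSeqTower P α S c) (h : T ⊆ closure (Submodule.span ℂ S : Set A)) :
    IsSeqTower P α T c where
  isSelfAdjoint := hc.isSelfAdjoint
  norm_le_one := hc.norm_le_one
  eval_eq_zero r a ha := hc.closure_span.eval_eq_zero r a (h ha)

theorem map (hc : IsSeqTower P α S c) (f : A →⋆ₙₐ[ℂ] B) (hf : ∀ g a, f (α g a) = β g (f a)) :
    IsSeqTower P β (f '' S) fun l x => SeqAlg.map f (c l x) where
  isSelfAdjoint l x := (hc.isSelfAdjoint l x).map (SeqAlg.map f)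
  norm_le_one l x := (NonUnitalStarAlgHom.norm_apply_le _ _).trans (hc.norm_le_one l x)
  eval_eq_zero := by
    rintro r _ ⟨a, ha, rfl⟩
    rw [← SeqAlg.map_constSeq, ← TowerRel.map_eval (α := α.seqAlg) (SeqAlg.map f)
      (SeqAlg.map_seqAlg α β f hf), hc.eval_eq_zero r a ha, map_zero]

/-- A tower relative to `S` restricts, at a late enough index, to an approximate tower in `A`. -/
theorem exists_approx (hc : IsSeqTower P α S c) {F : Finset A} {R : Finset (TowerRel P H d)}
    {δ ε : ℝ} (hF : ∀ a ∈ F, ∃ b ∈ S, ‖a - b‖ ≤ δ) (hδ : TowerRel.evalBound H d * δ < ε) :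
    ∃ b : Fin (d + 1) → G ⧸ H → A, (∀ l x, IsSelfAdjoint (b l x)) ∧ (∀ l x, ‖b l x‖ ≤ 1) ∧
      ∀ r ∈ R, ∀ a ∈ F, ‖r.eval α b a‖ < ε := by
  choose b hb1 hb2 hb3 using fun l x =>
    (c0Ideal A).exists_selfAdjoint_lift (hc.isSelfAdjoint l x) (hc.norm_le_one l x)
  have hK : 0 ≤ TowerRel.evalBound H d := by unfold TowerRel.evalBound; positivity
  have key : ∀ᶠ n in Filter.atTop, ∀ r ∈ R, ∀ a ∈ F,
      ‖r.eval α (fun l x => b l x n) a‖ < ε := by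
    rw [Filter.eventually_all_finset]
    intro r _
    rw [Filter.eventually_all_finset]
    intro a ha
    obtain ⟨a', ha', hd⟩ := hF a ha
    have h1 : ‖r.eval α.seqAlg c (constSeq a)‖ < ε := by
      -- The defect vanishes at `a'`, so by linearity only the small difference `a - a'`
      -- contributes.
      have h2 : r.eval α.seqAlg c (constSeq a) = r.eval α.seqAlg c (constSeq (a - a')) := by
        rw [map_sub, map_sub, hc.eval_eq_zero r a' ha', sub_zero]
      rw [h2]
      calc _ ≤ TowerRel.evalBound H d * ‖(constSeq (a - a') : SeqAlg A)‖ :=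
            r.norm_eval_le _ hc.norm_le_one _
        _ ≤ TowerRel.evalBound H d * δ := by gcongr; exact (norm_constSeq_le _).trans hd
        _ < ε := hδ
    have h3 : r.eval α.seqAlg c (constSeq a)
        = (c0Ideal A).proj (r.eval α.bddSeq b (BddSeq.const a)) := by
      rw [TowerRel.map_eval (β := α.seqAlg) (c0Ideal A).proj (fun _ _ => rfl)]
      simp only [hb3, proj_const]
    rw [h3] at h1
    filter_upwards [eventually_norm_lt_of_norm_proj_lt h1] with n hn
    rw [← BddSeq.eval_apply, TowerRel.map_eval (β := α) (BddSeq.eval n) (fun _ _ => rfl)] at hn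
    exact hn
  obtain ⟨n, hn⟩ := key.exists
  exact ⟨fun l x => b l x n, fun l x => (hb1 l x).map (BddSeq.eval n),
    fun l x => (BddSeq.norm_apply_le _ n).trans (hb2 l x), hn⟩

end IsSeqTower

/-- Approximate towers in `A` assemble to towers in the sequence algebra. -/
theorem HasSeqTowers.of_approx [Countable G] {α : CStarAction G A}
    (h : ∀ (F : Finset A) (R : Finset (TowerRel P H d)) (ε : ℝ), 0 < ε →
      ∃ b : Fin (d + 1) → G ⧸ H → A, (∀ l x, IsSelfAdjoint (b l x)) ∧ (∀ l x, ‖b l x‖ ≤ 1) ∧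
        ∀ r ∈ R, ∀ a ∈ F, ‖r.eval α b a‖ < ε) :
    HasSeqTowers P α H d := by
  classical
  intro S hS
  -- Adjoining `0` makes the set nonempty, hence enumerable by `ℕ`.
  obtain ⟨s, hs⟩ := (hS.insert (0 : A)).exists_eq_range (Set.insert_nonempty _ _)
  have : Nonempty (TowerRel P H d) := ⟨.sum⟩
  obtain ⟨ρ, hρ⟩ := exists_surjective_nat (TowerRel P H d)
  -- The `n`-th approximate tower serves the first `n + 1` elements and relations with tolerance `1
  -- / (n + 1)`.
  choose b hb1 hb2 hb3 using fun n : ℕ =>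
    h ((Finset.range (n + 1)).image s) ((Finset.range (n + 1)).image ρ) (1 / (n + 1))
      (by positivity)
  let c : Fin (d + 1) → G ⧸ H → BddSeq A := fun l x => BddSeq.mk (fun n => b n l x) 1
    fun n => hb2 n l x
  refine ⟨fun l x => (c0Ideal A).proj (c l x), fun l x => ?_, fun l x => ?_, fun r a ha => ?_⟩
  · have : IsSelfAdjoint (c l x) := lp.ext (funext fun n => hb1 n l x)
    exact this.map (c0Ideal A).proj
  · exact ((c0Ideal A).norm_proj_le _).trans (BddSeq.norm_mk_le _ _ _)
  · obtain ⟨i, rfl⟩ : a ∈ Set.range s := hs ▸ Set.mem_insert_of_mem _ ha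
    obtain ⟨j, rfl⟩ := hρ r
    rw [← proj_const, ← TowerRel.map_eval (α := α.bddSeq) (β := α.seqAlg) (c0Ideal A).proj
      (fun _ _ => rfl), proj_seq_eq_zero_iff]
    refine squeeze_zero' (.of_forall fun _ => norm_nonneg _) ?_
      tendsto_one_div_add_atTop_nhds_zero_nat
    filter_upwards [Filter.eventually_ge_atTop i, Filter.eventually_ge_atTop j] with n hi hj
    rw [← BddSeq.eval_apply, TowerRel.map_eval (β := α) (BddSeq.eval n) (fun _ _ => rfl)]
    exact (hb3 n _ (Finset.mem_image_of_mem ρ (Finset.mem_range.mpr (by omega))) _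
      (Finset.mem_image_of_mem s (Finset.mem_range.mpr (by omega)))).le

end TowerRelations

/-! ### Completely positive order zero maps on finite-dimensional commutative algebras -/

section OrderZero

variable {A B : Type*} [NonUnitalCStarAlgebra A] [NonUnitalCStarAlgebra B]

/-- Positive elements have self-adjoint square roots. Applied to the projections
$\delta_x=\delta_x^*\delta_x$, this yields the elements of a tower. -/
theorem IsCompletelyPositive.exists_selfAdjoint_mul_self {φ : A →ₗ[ℂ] B}
    (hφ : IsCompletelyPositive φ) (a : A) :
    ∃ q : B, IsSelfAdjoint q ∧ q * q = φ (star a * a) := by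
  let _ := CStarAlgebra.spectralOrder A
  let _ := CStarAlgebra.spectralOrder B
  have := CStarAlgebra.spectralOrderedRing A
  have := CStarAlgebra.spectralOrderedRing B
  obtain ⟨ψ, rfl⟩ := hφ
  have h : 0 ≤ ψ (star a * a) := map_nonneg ψ (star_mul_self_nonneg a)
  exact ⟨CFC.sqrt (ψ (star a * a)), IsSelfAdjoint.of_nonneg (CFC.sqrt_nonneg _),
    CFC.sqrt_mul_sqrt_self _ h⟩

theorem exists_eq_star_mul_self_of_nonneg [PartialOrder A] [StarOrderedRing A] {a : A}
    (ha : 0 ≤ a) : ∃ b, a = star b * b :=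
  CStarAlgebra.nonneg_iff_eq_star_mul_self.mp ha

variable {ι : Type*} [Fintype ι]

theorem sum_mul_sum_of_orthogonal {p q : ι → B} (h : ∀ x y, x ≠ y → p x * q y = 0) :
    (∑ x, p x) * ∑ x, q x = ∑ x, p x * q x := by
  rw [Finset.sum_mul_sum]
  refine Finset.sum_congr rfl fun x _ => ?_
  exact Finset.sum_eq_single x (fun y _ hy => h x y hy.symm) (by simp)

/-- A sum of orthogonal self-adjoint contractions is a contraction. -/
theorem norm_sum_le_one_of_orthogonal {p : ι → B} (hsa : ∀ x, IsSelfAdjoint (p x))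
    (hp : ∀ x, ‖p x‖ ≤ 1) (horth : ∀ x y, x ≠ y → p x * p y = 0) : ‖∑ x, p x‖ ≤ 1 := by
  -- Squaring preserves the hypotheses because $(\sum p_x)^2=\sum p_x^2$. Hence the $2^k$-th power
  -- of the norm is bounded by the number of summands for every $k$, which forces the norm to be at
  -- most $1$.
  have key : ∀ (k : ℕ) (p : ι → B), (∀ x, IsSelfAdjoint (p x)) → (∀ x, ‖p x‖ ≤ 1) →
      (∀ x y, x ≠ y → p x * p y = 0) → ‖∑ x, p x‖ ^ 2 ^ k ≤ Fintype.card ι := by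
    intro k
    induction k with
    | zero =>
      intro p _ hp _
      rw [pow_zero, pow_one]
      refine (norm_sum_le _ _).trans ((Finset.sum_le_sum fun x _ => hp x).trans ?_)
      simp
    | succ k ih =>
      intro p hsa hp horth
      have hs : IsSelfAdjoint (∑ x, p x) := isSelfAdjoint_sum _ fun x _ => hsa x
      rw [pow_succ', pow_mul, ← hs.norm_mul_self, sum_mul_sum_of_orthogonal horth]
      refine ih _ (fun x => ?_) (fun x => ?_) fun x y hxy => ?_
      · rw [IsSelfAdjoint, star_mul, (hsa x).star_eq]
      · exact (norm_mul_le _ _).trans (mul_le_one₀ (hp x) (norm_nonneg _) (hp x))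
      · rw [mul_assoc, ← mul_assoc (p x) (p y), horth x y hxy, zero_mul, mul_zero]
  by_contra! h
  obtain ⟨k, hk⟩ := pow_unbounded_of_one_lt (Fintype.card ι : ℝ) h
  have h1 : ‖∑ x, p x‖ ^ k ≤ ‖∑ x, p x‖ ^ 2 ^ k :=
    pow_le_pow_right₀ h.le Nat.lt_two_pow_self.le
  exact absurd (key k p hsa hp horth) (not_le.mpr (hk.trans_le h1))

/-- The linear map `f ↦ ∑ x, f x • p x`. -/
def sumMap (p : ι → B) : (ι → ℂ) →ₗ[ℂ] B := ∑ x, (LinearMap.proj x).smulRight (p x)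

@[simp] theorem sumMap_apply (p : ι → B) (f : ι → ℂ) : sumMap p f = ∑ x, f x • p x := by
  simp [sumMap]

/-- A positive matrix is $N^*N$, and its image is $\sum_x W_x^*W_x$ with $W_x=N(x)\otimes c_x$. No
orthogonality is needed here. -/
theorem isCompletelyPositive_sumMap {c : ι → B} (hc : ∀ x, IsSelfAdjoint (c x)) :
    IsCompletelyPositive (sumMap fun x => c x * c x) := by
  let _ := CStarAlgebra.spectralOrder (ι → ℂ)
  let _ := CStarAlgebra.spectralOrder B
  have := CStarAlgebra.spectralOrderedRing (ι → ℂ)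
  have := CStarAlgebra.spectralOrderedRing B
  refine ⟨⟨sumMap fun x => c x * c x, fun k M hM => ?_⟩, rfl⟩
  obtain ⟨N, rfl⟩ := exists_eq_star_mul_self_of_nonneg hM
  let W : ι → CStarMatrix (Fin k) (Fin k) B := fun x =>
    CStarMatrix.ofMatrix fun i j => N i j x • c x
  have hW : (star N * N).map (sumMap fun x => c x * c x) = ∑ x, star (W x) * W x := by
    ext i j
    have h1 : ∀ x, (star (W x) * W x) i j = (star N * N) i j x • (c x * c x) := by
      intro x
      rw [CStarMatrix.mul_apply, CStarMatrix.mul_apply, Finset.sum_apply, Finset.sum_smul]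
      refine Finset.sum_congr rfl fun m _ => ?_
      change star (N m i x • c x) * (N m j x • c x) = (star (N m i x) * N m j x) • (c x * c x)
      rw [star_smul, (hc x).star_eq, smul_mul_smul_comm]
    have h2 : (∑ x, star (W x) * W x) i j = ∑ x, (star (W x) * W x) i j := by
      exact map_sum (⟨⟨fun M : CStarMatrix (Fin k) (Fin k) B => M i j, rfl⟩, fun _ _ => rfl⟩ :
        CStarMatrix (Fin k) (Fin k) B →+ B) _ _
    rw [h2, Finset.sum_congr rfl fun x _ => h1 x]
    exact sumMap_apply _ _
  rw [hW]
  exact Finset.sum_nonneg fun x _ => star_mul_self_nonneg (W x)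

/-- Orthogonality gives $\varphi(f)\varphi(g)=\sum_x f(x)g(x)c_x^4$, so products with $fg=0$ vanish.
For $\|f\|\le1$ it exhibits $\varphi(f)^*\varphi(f)$ as a sum of orthogonal self-adjoint
contractions. -/
theorem isCcpOrderZero_sumMap {c : ι → B} (hsa : ∀ x, IsSelfAdjoint (c x))
    (hc : ∀ x, ‖c x‖ ≤ 1) (horth : ∀ x y, x ≠ y → c x * c x * (c y * c y) = 0) :
    IsCcpOrderZero (sumMap fun x => c x * c x) := by
  have hp : ∀ x, ‖c x * c x‖ ≤ 1 := fun x =>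
    (norm_mul_le _ _).trans (mul_le_one₀ (hc x) (norm_nonneg _) (hc x))
  have hps : ∀ x, IsSelfAdjoint (c x * c x) := fun x => by
    rw [IsSelfAdjoint, star_mul, (hsa x).star_eq]
  have hmul : ∀ f g : ι → ℂ, sumMap (fun x => c x * c x) f * sumMap (fun x => c x * c x) g
      = ∑ x, (f x * g x) • (c x * c x * (c x * c x)) := by
    intro f g
    rw [sumMap_apply, sumMap_apply, sum_mul_sum_of_orthogonal]
    · exact Finset.sum_congr rfl fun x _ => smul_mul_smul_comm _ _ _ _
    · intro x y hxy
      rw [smul_mul_smul_comm, horth x y hxy, smul_zero]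
  have hstar : ∀ f : ι → ℂ, star (sumMap (fun x => c x * c x) f)
      = sumMap (fun x => c x * c x) (star f) := by
    intro f
    simp only [sumMap_apply, star_sum, star_smul, (hps _).star_eq, Pi.star_apply]
  refine ⟨isCompletelyPositive_sumMap hsa, fun f => ?_, fun f g h => ?_⟩
  · have h1 : ∀ f : ι → ℂ, ‖f‖ ≤ 1 → ‖sumMap (fun x => c x * c x) f‖ ≤ 1 := by
      intro f hf
      have hfx : ∀ x, ‖f x‖ ≤ 1 := fun x => (norm_le_pi_norm f x).trans hf
      have h2 : ‖∑ x, (star f x * f x) • (c x * c x * (c x * c x))‖ ≤ 1 := by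
        refine norm_sum_le_one_of_orthogonal (fun x => ?_) (fun x => ?_) fun x y hxy => ?_
        · rw [IsSelfAdjoint, star_smul, star_mul (c x * c x), (hps x).star_eq, star_mul,
            Pi.star_apply, star_star]
        · rw [norm_smul]
          refine mul_le_one₀ ?_ (norm_nonneg _) ?_
          · rw [norm_mul, Pi.star_apply, norm_star]
            exact mul_le_one₀ (hfx x) (norm_nonneg _) (hfx x)
          · exact (norm_mul_le _ _).trans (mul_le_one₀ (hp x) (norm_nonneg _) (hp x))
        · rw [smul_mul_smul_comm, mul_assoc (c x * c x), ← mul_assoc (c x * c x) (c y * c y),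
            horth x y hxy, zero_mul, mul_zero, smul_zero]
      rw [← hmul, ← hstar, CStarRing.norm_star_mul_self] at h2
      by_contra! h3
      nlinarith
    rcases eq_or_ne f 0 with rfl | hf
    · simp
    · have hpos : 0 < ‖f‖ := norm_pos_iff.mpr hf
      have h2 := h1 ((‖f‖⁻¹ : ℂ) • f) (by rw [norm_smul]; simp [hpos.ne'])
      rw [map_smul, norm_smul, norm_inv, Complex.norm_real, norm_norm, inv_mul_le_iff₀ hpos,
        mul_one] at h2
      exact h2
  · have hzero : ∀ u v : ι → ℂ, u * v = 0 →
        sumMap (fun x => c x * c x) u * sumMap (fun x => c x * c x) v = 0 := by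
      intro u v huv
      rw [hmul]
      refine Finset.sum_eq_zero fun x _ => ?_
      rw [show u x * v x = 0 from congrFun huv x, zero_smul]
    exact ⟨hzero _ _ h.1, hzero _ _ h.2.1, by rw [hstar]; exact hzero _ _ h.2.2.1,
      by rw [hstar]; exact hzero _ _ h.2.2.2⟩

end OrderZero

/-! ### Separable invariant subalgebras -/

/-- Every element of the closure is the value of a nonempty word in `s`, and there are countably
many such words. -/
theorem countable_subsemigroup_closure {M : Type*} [Semigroup M] {s : Set M} (hs : s.Countable) :
    (Subsemigroup.closure s : Set M).Countable := by
  have : Countable s := hs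
  have : Countable (FreeSemigroup s) :=
    Function.Injective.countable (f := fun w : FreeSemigroup s => (w.head, w.tail))
      fun v w h => by cases v; cases w; simp_all
  refine (Set.countable_range (FreeSemigroup.lift (Subtype.val : s → M))).mono ?_
  have : Subsemigroup.closure s ≤ (FreeSemigroup.lift (Subtype.val : s → M)).srange :=
    Subsemigroup.closure_le.mpr fun x hx => ⟨FreeSemigroup.of ⟨x, hx⟩, by simp⟩
  exact fun x hx => this hx

/-- Take the closed star subalgebra generated by the orbit of `S`. Before closing up, it is the
linear span of the countably many words in the orbit and its adjoints. -/
theorem exists_separable_invariant {G A : Type*} [Group G] [Countable G] [NonUnitalCStarAlgebra A]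
    (α : CStarAction G A) {S : Set A} (hS : S.Countable) :
    ∃ D : NonUnitalStarSubalgebra ℂ A, IsClosed (D : Set A) ∧
      TopologicalSpace.IsSeparable (D : Set A) ∧ (∀ g, ∀ x ∈ D, α g x ∈ D) ∧ S ⊆ D := by
  let T : Set A := ⋃ g : G, α g '' S
  have hT : T.Countable := Set.countable_iUnion fun g => hS.image _
  have hST : S ⊆ T := fun x hx => Set.mem_iUnion.mpr ⟨1, x, hx, by simp⟩
  let D₀ := NonUnitalStarAlgebra.adjoin ℂ T
  refine ⟨D₀.topologicalClosure, D₀.isClosed_topologicalClosure, ?_, fun g => ?_,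
    hST.trans ((NonUnitalStarAlgebra.subset_adjoin ℂ T).trans D₀.le_topologicalClosure)⟩
  · change TopologicalSpace.IsSeparable (closure (D₀ : Set A))
    refine TopologicalSpace.IsSeparable.closure ?_
    have h1 : (D₀ : Set A) = Submodule.span ℂ (Subsemigroup.closure (T ∪ star T) : Set A) :=
      congrArg (fun M : Submodule ℂ A => (M : Set A)) (NonUnitalStarAlgebra.adjoin_eq_span T)
    rw [h1]
    have h2 : (star T).Countable := by
      rw [← Set.image_star]; exact hT.image _
    exact (countable_subsemigroup_closure (hT.union h2)).isSeparable.span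
  · have hcont : Continuous (α g) := AddMonoidHomClass.continuous_of_bound (α g) 1 fun x => by
      rw [one_mul]; exact NonUnitalStarAlgHom.norm_apply_le (α g) x
    have h1 : D₀ ≤ (D₀.comap (α g).toNonUnitalStarAlgHom) := by
      refine NonUnitalStarAlgebra.adjoin_le ?_
      rintro x hx
      obtain ⟨h, y, hy, rfl⟩ := Set.mem_iUnion.mp hx
      refine NonUnitalStarAlgebra.subset_adjoin ℂ T (Set.mem_iUnion.mpr ⟨g * h, y, hy, ?_⟩)
      rw [map_mul]
      rfl
    intro x hx
    exact map_mem_closure hcont hx h1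

/-! ### Rokhlin towers in `F(D, A)` and in the sequence algebra -/

section Equivalence

variable {G : Type*} [Group G] {A : Type*} [NonUnitalCStarAlgebra A]
  {P : Prop} {H : Subgroup G} [H.FiniteIndex] {d : ℕ}

attribute [local instance] Subgroup.fintypeQuotientOfFiniteIndex

/-- Common form of `RokhlinDimRelLE` (for `P = False`) and `RokhlinDimCommRelLE` (for
`P = True`). -/
def RokhlinLE (P : Prop) (α : CStarAction G A) (H : Subgroup G) [H.FiniteIndex] (d : ℕ) : Prop :=
  ∀ (D : NonUnitalStarSubalgebra ℂ A), IsClosed (D : Set A) →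
    TopologicalSpace.IsSeparable (D : Set A) → ∀ hD : ∀ g, ∀ x ∈ D, α g x ∈ D,
      ∃ φ : Fin (d + 1) → (CosetFun H →ₗ[ℂ] CentralSeqAlg D), IsRokhlinTower α H D hD d φ ∧
        (P → ∀ k l, k ≠ l → ∀ f₁ f₂, φ k f₁ * φ l f₂ = φ l f₂ * φ k f₁)

theorem rokhlinLE_false_iff {α : CStarAction G A} :
    RokhlinLE False α H d ↔ RokhlinDimRelLE α H d := by
  simp [RokhlinLE, RokhlinDimRelLE]

theorem rokhlinLE_true_iff {α : CStarAction G A} :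
    RokhlinLE True α H d ↔ RokhlinDimCommRelLE α H d := by
  simp [RokhlinLE, RokhlinDimCommRelLE]

theorem mul_constSeq_eq_zero_of_proj_eq_zero {D : NonUnitalStarSubalgebra ℂ A}
    {z : relCommutant D} (hz : (annIdeal D).proj z = 0) {a : A} (ha : a ∈ D) :
    (z : SeqAlg A) * constSeq a = 0 :=
  ((annIdeal D).proj_eq_zero_iff.mp hz a ha).1

/-- Elements of the relative commutant commute with `D`, so annihilation from one side suffices.
This is why the defects use left multiplication only. -/
theorem proj_eq_zero_of_mul_constSeq_eq_zero {D : NonUnitalStarSubalgebra ℂ A}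
    {z : relCommutant D} (hz : ∀ a ∈ D, (z : SeqAlg A) * constSeq a = 0) :
    (annIdeal D).proj z = 0 :=
  (annIdeal D).proj_eq_zero_iff.mpr fun a ha => ⟨hz a ha, by rw [← z.2 a ha]; exact hz a ha⟩

/-- A two-sided sequence unit for a countable dense subset is one for all of `D` by continuity; it
commutes with `D` because both products with `a` equal `a`. -/
theorem exists_relCommutant_unit {D : NonUnitalStarSubalgebra ℂ A}
    (hsep : TopologicalSpace.IsSeparable (D : Set A)) :
    ∃ e : relCommutant D, ∀ a ∈ D, (e : SeqAlg A) * constSeq a = constSeq a := by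
  obtain ⟨S, -, hS, hDS⟩ := hsep.exists_countable_dense_subset
  obtain ⟨e, -, -, he⟩ := exists_seq_unit hS
  have hcl : IsClosed {a : A | (c0Ideal A).proj e * constSeq a = constSeq a ∧
      constSeq a * (c0Ideal A).proj e = constSeq a} :=
    (isClosed_eq (continuous_const.mul continuous_constSeq) continuous_constSeq).inter
      (isClosed_eq (continuous_constSeq.mul continuous_const) continuous_constSeq)
  have h : ∀ a ∈ D, (c0Ideal A).proj e * constSeq a = constSeq a ∧
      constSeq a * (c0Ideal A).proj e = constSeq a := fun a ha => closure_minimal he hcl (hDS ha)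
  exact ⟨⟨(c0Ideal A).proj e, fun a ha => (h a ha).1.trans (h a ha).2.symm⟩, fun a ha => (h a ha).1⟩

theorem cosetShift_single {K : Subgroup G} [DecidableEq (G ⧸ K)] (t : G) (x : G ⧸ K) :
    cosetShift K t (Pi.single x 1) = Pi.single (t • x) 1 := by
  funext y
  simp only [cosetShift, Pi.single_apply, inv_smul_eq_iff]

/-- The tower consists of lifts to $A_\infty\cap D'$ of square roots of $\varphi_\ell(\delta_x)$.
Identities in $F(D,A)$ become identities after multiplication by elements of `D`. -/
theorem IsRokhlinTower.exists_isSeqTower {α : CStarAction G A} {D : NonUnitalStarSubalgebra ℂ A}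
    (hsep : TopologicalSpace.IsSeparable (D : Set A)) {hD : ∀ g, ∀ x ∈ D, α g x ∈ D}
    {φ : Fin (d + 1) → (CosetFun H →ₗ[ℂ] CentralSeqAlg D)} (hφ : IsRokhlinTower α H D hD d φ)
    (hcomm : P → ∀ k l, k ≠ l → ∀ f₁ f₂, φ k f₁ * φ l f₂ = φ l f₂ * φ k f₁) :
    ∃ c : Fin (d + 1) → G ⧸ H → SeqAlg A, IsSeqTower P α (D : Set A) c := by
  classical
  let δ : G ⧸ H → CosetFun H := fun x => Pi.single x 1
  have hδ : ∀ x, star (δ x) * δ x = δ x := by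
    intro x
    funext y
    simp only [δ, Pi.mul_apply, Pi.star_apply, Pi.single_apply]
    split_ifs <;> simp
  have hδ1 : ∀ x, ‖δ x‖ ≤ 1 := fun x => by
    refine (pi_norm_le_iff_of_nonneg zero_le_one).mpr fun y => ?_
    simp only [δ, Pi.single_apply]
    split_ifs <;> simp
  choose q hq hqq using fun l x =>
    (hφ.ccp_orderZero l).completelyPositive.exists_selfAdjoint_mul_self (δ x)
  simp only [hδ] at hqq
  have hq1 : ∀ l x, ‖q l x‖ ≤ 1 := by
    intro l x
    have h1 : ‖q l x‖ ^ 2 ≤ 1 := by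
      rw [← (hq l x).norm_mul_self, hqq]
      exact ((hφ.ccp_orderZero l).contractive _).trans (hδ1 x)
    exact (sq_le_one_iff₀ (norm_nonneg _)).mp h1
  choose c hc hc1 hcq using fun l x => (annIdeal D).exists_selfAdjoint_lift (hq l x) (hq1 l x)
  have hpc : ∀ l x, (annIdeal D).proj (c l x * c l x) = φ l (δ x) := by
    intro l x
    rw [map_mul, hcq, hqq]
  refine ⟨fun l x => c l x, fun l x => congrArg Subtype.val (hc l x), fun l x => hc1 l x,
    fun r a ha => ?_⟩
  cases r with
  | sum =>
    -- The unit condition speaks of elements of $F(D,A)$; testing it on the class of `e` turns it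
    -- into a statement about `a = e * a`.
    obtain ⟨e, he⟩ := exists_relCommutant_unit hsep
    have h1 : (annIdeal D).proj (∑ l, ∑ x, c l x * c l x) = ∑ l, φ l 1 := by
      rw [map_sum]
      refine Finset.sum_congr rfl fun l _ => ?_
      rw [map_sum, Finset.sum_congr rfl fun x _ => hpc l x, ← map_sum]
      exact congrArg (φ l) (Finset.univ_sum_single (1 : CosetFun H))
    have h2 : (annIdeal D).proj ((∑ l, ∑ x, c l x * c l x) * e - e) = 0 := by
      rw [map_sub, map_mul, h1, (hφ.sum_isUnit _).1, sub_self]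
    have h3 := mul_constSeq_eq_zero_of_proj_eq_zero h2 ha
    have h4 : (((∑ l, ∑ x, c l x * c l x) * e - e : relCommutant D) : SeqAlg A)
        = (∑ l, ∑ x, (c l x : SeqAlg A) * c l x) * e - e := by
      push_cast
      rfl
    rw [h4, sub_mul, mul_assoc, he a ha] at h3
    exact h3
  | orth l x y hxy =>
    have hxy' : CStarOrthogonal (δ x) (δ y) := by
      have h1 : ∀ x y : G ⧸ H, x ≠ y → δ x * δ y = 0 := by
        intro x y hxy
        funext z
        simp only [δ, Pi.mul_apply, Pi.single_apply, Pi.zero_apply]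
        split_ifs with h1 h2
        · exact absurd (h1.symm.trans h2) hxy
        all_goals simp
      have h2 : ∀ x, star (δ x) = δ x := by
        intro x
        funext z
        simp only [δ, Pi.star_apply, Pi.single_apply]
        split_ifs <;> simp
      exact ⟨h1 x y hxy, h1 y x hxy.symm, by rw [h2]; exact h1 x y hxy,
        by rw [h2]; exact h1 y x hxy.symm⟩
    refine mul_constSeq_eq_zero_of_proj_eq_zero (z := c l x * c l x * (c l y * c l y)) ?_ ha
    rw [map_mul, hpc, hpc]
    exact ((hφ.ccp_orderZero l).orderZero _ _ hxy').1
  | equiv g l x =>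
    refine mul_constSeq_eq_zero_of_proj_eq_zero
      (z := α.relCommutant D hD g (c l x * c l x) - c l (g • x) * c l (g • x)) ?_ ha
    rw [map_sub, hpc, sub_eq_zero]
    change α.centralSeqAlg D hD g ((annIdeal D).proj (c l x * c l x)) = _
    rw [hpc, ← hφ.equivariant, cosetShift_single]
  | central l x => exact sub_eq_zero.mpr ((c l x).2 a ha)
  | comm k l x y hP hkl =>
    refine mul_constSeq_eq_zero_of_proj_eq_zero
      (z := c k x * c k x * (c l y * c l y) - c l y * c l y * (c k x * c k x)) ?_ ha
    rw [map_sub, map_mul, map_mul _ (c l y * c l y), hpc, hpc, sub_eq_zero]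
    exact hcomm hP k l hkl _ _

/-- The centrality relation places `c` in $A_\infty\cap D'$, and $\varphi_\ell(f)=\sum_x
f(x)q_{\ell,x}^2$ for the classes $q_{\ell,x}$ of $c_{\ell,x}$. Each property of $\varphi_\ell$
reduces to the basis elements $\delta_x$. -/
theorem IsSeqTower.exists_isRokhlinTower {α : CStarAction G A} {D : NonUnitalStarSubalgebra ℂ A}
    (hD : ∀ g, ∀ x ∈ D, α g x ∈ D) {c : Fin (d + 1) → G ⧸ H → SeqAlg A}
    (hc : IsSeqTower P α (D : Set A) c) :
    ∃ φ : Fin (d + 1) → (CosetFun H →ₗ[ℂ] CentralSeqAlg D), IsRokhlinTower α H D hD d φ ∧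
        (P → ∀ k l, k ≠ l → ∀ f₁ f₂, φ k f₁ * φ l f₂ = φ l f₂ * φ k f₁) := by
  let b : Fin (d + 1) → G ⧸ H → relCommutant D := fun l x =>
    ⟨c l x, fun a ha => sub_eq_zero.mp (hc.eval_eq_zero (.central l x) a ha)⟩
  let q : Fin (d + 1) → G ⧸ H → CentralSeqAlg D := fun l x => (annIdeal D).proj (b l x)
  have hb : ∀ l x, IsSelfAdjoint (b l x) := fun l x => Subtype.ext (hc.isSelfAdjoint l x)
  refine ⟨fun l => sumMap fun x => q l x * q l x, ⟨fun l => ?_, fun l t f => ?_, fun z => ?_⟩,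
    fun hP k l hkl f₁ f₂ => ?_⟩
  · refine isCcpOrderZero_sumMap (fun x => (hb l x).map _)
      (fun x => ((annIdeal D).norm_proj_le _).trans (hc.norm_le_one l x)) fun x y hxy => ?_
    simp only [q, ← map_mul]
    exact proj_eq_zero_of_mul_constSeq_eq_zero fun a ha => hc.eval_eq_zero (.orth l x y hxy) a ha
  · have hequiv : ∀ x, α.centralSeqAlg D hD t (q l x * q l x) = q l (t • x) * q l (t • x) := by
      intro x
      rw [← sub_eq_zero]
      exact proj_eq_zero_of_mul_constSeq_eq_zero
        (z := α.relCommutant D hD t (b l x * b l x) - b l (t • x) * b l (t • x))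
        fun a ha => hc.eval_eq_zero (.equiv t l x) a ha
    simp only [sumMap_apply, map_sum, map_smul, hequiv]
    -- Reindexing by `x ↦ t • x` absorbs the `t⁻¹` in the shift.
    refine (Fintype.sum_equiv (MulAction.toPerm t) _ _ fun x => ?_).symm
    simp [cosetShift]
  · have h1 : ∑ l, sumMap (fun x => q l x * q l x) 1
        = (annIdeal D).proj (∑ l, ∑ x, b l x * b l x) := by
      simp [q]
    have h2 : ((∑ l, ∑ x, b l x * b l x : relCommutant D) : SeqAlg A)
        = ∑ l, ∑ x, c l x * c l x := by
      push_cast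
      rfl
    have h3 : ∀ a ∈ D, (∑ l, ∑ x, c l x * c l x) * constSeq a = constSeq a := fun a ha =>
      sub_eq_zero.mp (hc.eval_eq_zero .sum a ha)
    obtain ⟨z, rfl⟩ := (annIdeal D).proj_surjective z
    rw [h1, ← map_mul, ← map_mul]
    constructor
    · rw [← sub_eq_zero, ← map_sub]
      refine proj_eq_zero_of_mul_constSeq_eq_zero fun a ha => ?_
      change ((∑ l, ∑ x, b l x * b l x : relCommutant D) * (z : SeqAlg A) - z) * constSeq a = 0
      rw [h2, sub_mul, mul_assoc, z.2 a ha, ← mul_assoc, h3 a ha, sub_self]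
    · rw [← sub_eq_zero, ← map_sub]
      refine proj_eq_zero_of_mul_constSeq_eq_zero fun a ha => ?_
      change ((z : SeqAlg A) * (∑ l, ∑ x, b l x * b l x : relCommutant D) - z) * constSeq a = 0
      rw [h2, sub_mul, mul_assoc, h3 a ha, sub_self]
  · have hcomm : ∀ x y, q k x * q k x * (q l y * q l y) = q l y * q l y * (q k x * q k x) := by
      intro x y
      rw [← sub_eq_zero]
      exact proj_eq_zero_of_mul_constSeq_eq_zero
        (z := b k x * b k x * (b l y * b l y) - b l y * b l y * (b k x * b k x))
        fun a ha => hc.eval_eq_zero (.comm k l x y hP hkl) a ha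
    simp only [sumMap_apply, Finset.sum_mul_sum, smul_mul_smul_comm, hcomm]
    rw [Finset.sum_comm]
    simp only [mul_comm]

/-- A countable set lies in a separable invariant subalgebra, and a separable subalgebra is the
closure of a countable set; towers pass in both directions by continuity of the defects. -/
theorem rokhlinLE_iff_hasSeqTowers [Countable G] {α : CStarAction G A} :
    RokhlinLE P α H d ↔ HasSeqTowers P α H d := by
  constructor
  · intro h S hS
    obtain ⟨D, hcl, hsep, hD, hSD⟩ := exists_separable_invariant α hS
    obtain ⟨φ, hφ, hcomm⟩ := h D hcl hsep hD
    obtain ⟨c, hc⟩ := hφ.exists_isSeqTower hsep hcomm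
    exact ⟨c, hc.mono fun a ha => subset_closure (Submodule.subset_span (hSD ha))⟩
  · intro h D _ hsep hD
    obtain ⟨S, -, hS, hDS⟩ := hsep.exists_countable_dense_subset
    obtain ⟨c, hc⟩ := h S hS
    exact (hc.mono (hDS.trans (closure_mono Submodule.subset_span))).exists_isRokhlinTower hD

end Equivalence

/-! ### Quotients and inductive limits -/

section Permanence

variable {G : Type*} [Group G] {A B : Type*} [NonUnitalCStarAlgebra A] [NonUnitalCStarAlgebra B]
  {P : Prop} {H : Subgroup G} [H.FiniteIndex] {d : ℕ}

attribute [local instance] Subgroup.fintypeQuotientOfFiniteIndex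

theorem HasSeqTowers.of_surjective {α : CStarAction G A} {β : CStarAction G B}
    (h : HasSeqTowers P α H d) (f : A →⋆ₙₐ[ℂ] B) (hf : ∀ g a, f (α g a) = β g (f a))
    (hsurj : Function.Surjective f) : HasSeqTowers P β H d := by
  intro S hS
  obtain ⟨c, hc⟩ := h (Function.surjInv hsurj '' S) (hS.image _)
  refine ⟨_, (hc.map f hf).mono fun a ha => subset_closure (Submodule.subset_span ?_)⟩
  exact ⟨_, ⟨a, ha, rfl⟩, Function.surjInv_eq hsurj a⟩

/-- An exact tower on nearby elements is an approximate tower on `F`, and approximate towers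
reassemble to exact ones in the sequence algebra. -/
theorem HasSeqTowers.of_locally [Countable G] {α : CStarAction G A}
    (h : ∀ (F : Finset A) (δ : ℝ), 0 < δ → ∃ S : Set A, (∀ a ∈ F, ∃ b ∈ S, ‖a - b‖ ≤ δ) ∧
      ∃ c : Fin (d + 1) → G ⧸ H → SeqAlg A, IsSeqTower P α S c) : HasSeqTowers P α H d := by
  refine HasSeqTowers.of_approx fun F R ε hε => ?_
  have hK : 0 < TowerRel.evalBound H d := by unfold TowerRel.evalBound; positivity
  -- The tolerance makes the total defect at most `ε / 2`, strictly below `ε`.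
  obtain ⟨S, hS, c, hc⟩ := h F (ε / 2 / TowerRel.evalBound H d) (by positivity)
  exact hc.exists_approx hS (by rw [mul_div_cancel₀ _ hK.ne']; linarith)

/-- An approximant from one stage can be pushed to all later stages. Having it eventually allows a
choice of stage that also carries towers, which exist only frequently. -/
theorem IsCStarInductiveLimit.exists_approx {A : ℕ → Type*} [∀ n, NonUnitalCStarAlgebra (A n)]
    {L : Type*} [NonUnitalCStarAlgebra L] {ι : ∀ n, A n →⋆ₙₐ[ℂ] A (n + 1)} {μ : ∀ n, A n →⋆ₙₐ[ℂ] L}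
    (hL : IsCStarInductiveLimit ι μ) (a : L) {δ : ℝ} (hδ : 0 < δ) :
    ∀ᶠ n in Filter.atTop, ∃ b : A n, ‖a - μ n b‖ ≤ δ := by
  obtain ⟨b, hb, hab⟩ := Metric.mem_closure_iff.mp (hL.dense a) δ hδ
  obtain ⟨n, b, rfl⟩ := Set.mem_iUnion.mp hb
  rw [dist_eq_norm] at hab
  filter_upwards [Filter.eventually_ge_atTop n] with m hm
  induction m, hm using Nat.le_induction with
  | base => exact ⟨b, hab.le⟩
  | succ m _ ih =>
    obtain ⟨b', hb'⟩ := ih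
    exact ⟨ι m b', by rwa [hL.compatible]⟩

theorem HasSeqTowers.of_inductiveLimit [Countable G] {A : ℕ → Type*}
    [∀ n, NonUnitalCStarAlgebra (A n)] {L : Type*} [NonUnitalCStarAlgebra L]
    {ι : ∀ n, A n →⋆ₙₐ[ℂ] A (n + 1)} {μ : ∀ n, A n →⋆ₙₐ[ℂ] L} {α : ∀ n, CStarAction G (A n)}
    {αL : CStarAction G L} (hL : IsCStarInductiveLimit ι μ)
    (hμ : ∀ n g a, αL g (μ n a) = μ n (α n g a))
    (h : ∃ᶠ n in Filter.atTop, HasSeqTowers P (α n) H d) : HasSeqTowers P αL H d := by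
  refine HasSeqTowers.of_locally fun F δ hδ => ?_
  have h1 : ∀ᶠ n in Filter.atTop, ∀ a ∈ F, ∃ b : A n, ‖a - μ n b‖ ≤ δ := by
    rw [Filter.eventually_all_finset]
    exact fun a _ => hL.exists_approx a hδ
  obtain ⟨n, hn, hF⟩ := (h.and_eventually h1).exists
  choose! b hb using hF
  obtain ⟨c, hc⟩ := hn (b '' F) (F.countable_toSet.image b)
  exact ⟨μ n '' (b '' F), fun a ha => ⟨_, ⟨_, ⟨a, ha, rfl⟩, rfl⟩, hb a ha⟩, _,
    hc.map (β := αL) (μ n) fun g a => (hμ n g a).symm⟩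

/-! ### Hereditary subalgebras -/

/-- For positive `a` one has $0\le eae\le\|a\|e^2$ with $e^2\in D$; the positive elements span `A`.
-/
theorem IsHereditary.conj_mem {D : NonUnitalStarSubalgebra ℂ A} (hD : IsHereditary D) {e : A}
    (he : e ∈ D) (hsa : IsSelfAdjoint e) (a : A) : e * a * e ∈ D := by
  let _ := CStarAlgebra.spectralOrder A
  have := CStarAlgebra.spectralOrderedRing A
  have ha : a ∈ Submodule.span ℂ {a : A | 0 ≤ a} := by
    rw [CStarAlgebra.span_nonneg]; trivial
  induction ha using Submodule.span_induction with
  | mem a ha =>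
    have ha : 0 ≤ a := ha
    have h1 : star e * a * e ≤ ‖a‖ • (star e * e) :=
      CStarAlgebra.star_left_conjugate_le_norm_smul (hb := IsSelfAdjoint.of_nonneg ha)
    have h2 : 0 ≤ star e * a * e := star_left_conjugate_nonneg ha e
    rw [hsa.star_eq] at h1 h2
    refine hD _ _ h2 h1 ?_
    have h3 : ‖a‖ • (e * e) = (‖a‖ : ℂ) • (e * e) := (Complex.coe_smul _ _).symm
    rw [h3]
    exact SMulMemClass.smul_mem _ (mul_mem he he)
  | zero => simp
  | add a b _ _ ha hb => rw [mul_add, add_mul]; exact add_mem ha hb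
  | smul z a _ ha => rw [mul_smul_comm, smul_mul_assoc]; exact SMulMemClass.smul_mem _ ha

/-- Compressing a tower by a local unit `e` of the orbit of `a` does not change its defects
at `a`. -/
theorem TowerRel.eval_conj {X : Type*} [NonUnitalCStarAlgebra X] (α : CStarAction G X)
    {c : Fin (d + 1) → G ⧸ H → X} {e a : X} (hea : ∀ g, e * α g a = α g a)
    (hae : ∀ g, α g a * e = α g a) (hca : ∀ l x g, c l x * α g a = α g a * c l x)
    (r : TowerRel P H d) :
    r.eval α (fun l x => e * c l x * e) a = r.eval α c a := by
  have h1 : ∀ l x g, e * c l x * e * α g a = c l x * α g a := by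
    intro l x g
    rw [mul_assoc, hea, mul_assoc, hca, ← mul_assoc, hea]
  have h2 : ∀ l x g, α g a * (e * c l x * e) = α g a * c l x := by
    intro l x g
    rw [← mul_assoc, ← mul_assoc, hae, ← hca, mul_assoc, hae]
  have hfa : ∀ l x g, c l x * c l x * α g a = α g a * (c l x * c l x) := by
    intro l x g
    rw [mul_assoc, hca, ← mul_assoc, hca, mul_assoc]
  have hf : ∀ l x g, e * c l x * e * (e * c l x * e) * α g a = c l x * c l x * α g a := by
    intro l x g
    rw [mul_assoc, h1, hca, ← mul_assoc, h1, hca, mul_assoc, ← hfa]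
  have hff : ∀ k l x y g, e * c k x * e * (e * c k x * e) * (e * c l y * e * (e * c l y * e)) * α g a
      = c k x * c k x * (c l y * c l y) * α g a := by
    intro k l x y g
    rw [mul_assoc, hf, hfa, ← mul_assoc, hf, mul_assoc, ← hfa, ← mul_assoc]
  have h1a : α 1 a = a := by simp
  cases r with
  | sum =>
    change (∑ l, ∑ x, _) * a - a = (∑ l, ∑ x, _) * a - a
    rw [← h1a]
    simp only [Finset.sum_mul, hf]
  | orth l x y h =>
    change _ * a = _ * a
    rw [← h1a, hff]
  | equiv g l x =>
    change (_ - _) * a = (_ - _) * a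
    -- The product of `α g (p)` with `a` is `α g (p * α g⁻¹ a)`, which is why `e` must be a unit on
    -- the whole orbit and not just at `a`.
    have h3 : α g (α g⁻¹ a) = a := by simp [← StarAlgEquiv.mul_apply]
    rw [sub_mul, sub_mul]
    congr 1
    · conv_lhs => rw [← h3]
      conv_rhs => rw [← h3]
      rw [← map_mul, ← map_mul, hf]
    · rw [← h1a, hf]
  | central l x =>
    change _ * a - a * _ = _ * a - a * _
    rw [← h1a, h1, h2]
  | comm k l x y hP h =>
    change (_ - _) * a = (_ - _) * a
    rw [← h1a, sub_mul, sub_mul, hff, hff]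

/-- Compress a tower of `A` termwise by a sequence unit `e` in `D` for the orbit of `S`; heredity
puts `e * b * e` in `D`. -/
theorem HasSeqTowers.restrict [Countable G] {α : CStarAction G A} (h : HasSeqTowers P α H d)
    (D : NonUnitalStarSubalgebra ℂ A) [IsClosed (D : Set A)] (hD : ∀ g, ∀ x ∈ D, α g x ∈ D)
    (hher : IsHereditary D) : HasSeqTowers P (α.restrict D hD) H d := by
  intro S hS
  let i : D →⋆ₙₐ[ℂ] A := NonUnitalStarSubalgebraClass.subtype D
  have hi : ∀ g a, i (α.restrict D hD g a) = α g (i a) := fun _ _ => rfl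
  let T : Set D := ⋃ g : G, α.restrict D hD g '' S
  have hT : T.Countable := Set.countable_iUnion fun g => hS.image _
  obtain ⟨c, hc⟩ := h (i '' T) (hT.image _)
  obtain ⟨e, he, he1, hunit⟩ := exists_seq_unit hT
  choose b hb hb1 hbc using fun l x =>
    (c0Ideal A).exists_selfAdjoint_lift (hc.isSelfAdjoint l x) (hc.norm_le_one l x)
  have hen : ∀ n, IsSelfAdjoint (e n) := fun n => he.map (BddSeq.eval n)
  have hin : ∀ n, IsSelfAdjoint (i (e n)) := fun n => (hen n).map i
  have hbound : ∀ l x n, ‖(⟨i (e n) * b l x n * i (e n),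
      hher.conj_mem (e n).2 (hin n) (b l x n)⟩ : D)‖ ≤ 1 := by
    intro l x n
    have h1 : ‖i (e n)‖ ≤ 1 := (BddSeq.norm_apply_le e n).trans he1
    have h2 : ‖b l x n‖ ≤ 1 := (BddSeq.norm_apply_le _ n).trans (hb1 l x)
    exact (norm_mul_le _ _).trans (mul_le_one₀ ((norm_mul_le _ _).trans
      (mul_le_one₀ h1 (norm_nonneg _) h2)) (norm_nonneg _) h1)
  let c' : Fin (d + 1) → G ⧸ H → BddSeq D := fun l x => BddSeq.mk _ 1 (hbound l x)
  let E : SeqAlg A := SeqAlg.map i ((c0Ideal D).proj e)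
  have hc' : ∀ l x, SeqAlg.map i ((c0Ideal D).proj (c' l x)) = E * c l x * E := by
    intro l x
    rw [← hbc]
    rfl
  refine ⟨fun l x => (c0Ideal D).proj (c' l x), fun l x => ?_, fun l x => ?_, fun r a ha => ?_⟩
  · have h1 : IsSelfAdjoint (c' l x) := by
      refine lp.ext (funext fun n => Subtype.ext ?_)
      have h2 : star (b l x n) = b l x n := (hb l x).map (BddSeq.eval n)
      change star (i (e n) * b l x n * i (e n)) = i (e n) * b l x n * i (e n)
      rw [star_mul, star_mul, (hin n).star_eq, h2, mul_assoc]
    exact h1.map (c0Ideal D).proj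
  · exact ((c0Ideal D).norm_proj_le _).trans (BddSeq.norm_mk_le _ _ _)
  · apply SeqAlg.map_injective i fun _ => rfl
    rw [map_zero, TowerRel.map_eval (β := α.seqAlg) _ (SeqAlg.map_seqAlg _ α i hi),
      SeqAlg.map_constSeq]
    simp only [hc']
    have haT : ∀ g, α.restrict D hD g a ∈ T := fun g => Set.mem_iUnion.mpr ⟨g, a, ha, rfl⟩
    have ha1 : i a ∈ i '' T := ⟨a, by simpa using haT 1, rfl⟩
    have hα : ∀ g, α.seqAlg g (constSeq (i a)) = SeqAlg.map i (constSeq (α.restrict D hD g a)) :=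
      fun _ => rfl
    rw [TowerRel.eval_conj α.seqAlg (a := constSeq (i a)), hc.eval_eq_zero r _ ha1]
    · intro g
      rw [hα, ← map_mul, (hunit _ (haT g)).1]
    · intro g
      rw [hα, ← map_mul, (hunit _ (haT g)).2]
    · intro l x g
      exact sub_eq_zero.mp (hc.eval_eq_zero (.central l x) _ ⟨_, haT g, rfl⟩)

end Permanence

/-! ### Tensor products -/

/-- A bilinear map that is multiplicative and ⋆-preserving in both variables jointly, such as
`(a, b) ↦ a ⊗ b`. -/
structure IsStarBilinear {A B C : Type*} [NonUnitalCStarAlgebra A] [NonUnitalCStarAlgebra B]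
    [NonUnitalCStarAlgebra C] (t : A →ₗ[ℂ] B →ₗ[ℂ] C) : Prop where
  map_mul : ∀ a a' b b', t (a * a') (b * b') = t a b * t a' b'
  map_star : ∀ a b, t (star a) (star b) = star (t a b)

namespace IsStarBilinear

variable {A B C : Type*} [NonUnitalCStarAlgebra A] [NonUnitalCStarAlgebra B]
  [NonUnitalCStarAlgebra C] {t : A →ₗ[ℂ] B →ₗ[ℂ] C}

theorem flip (ht : IsStarBilinear t) : IsStarBilinear t.flip where
  map_mul a a' b b' := ht.map_mul b b' a a'
  map_star a b := ht.map_star b a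

/-- For $b=y^*y$ the map $a\mapsto t(a,b)$ is positive, since $t(x^*x,y^*y)=t(x,y)^*t(x,y)$, and
positive maps are bounded. Positive elements span `B`. -/
theorem exists_bound_left (ht : IsStarBilinear t) (b : B) : ∃ K : ℝ, ∀ a, ‖t a b‖ ≤ K * ‖a‖ := by
  let _ := CStarAlgebra.spectralOrder A
  let _ := CStarAlgebra.spectralOrder B
  let _ := CStarAlgebra.spectralOrder C
  have := CStarAlgebra.spectralOrderedRing A
  have := CStarAlgebra.spectralOrderedRing B
  have := CStarAlgebra.spectralOrderedRing C
  have hb : b ∈ Submodule.span ℂ {b : B | 0 ≤ b} := by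
    rw [CStarAlgebra.span_nonneg]; trivial
  induction hb using Submodule.span_induction with
  | mem b hb =>
    have hb : 0 ≤ b := hb
    obtain ⟨y, rfl⟩ := CStarAlgebra.nonneg_iff_eq_star_mul_self.mp hb
    have hpos : ∀ a : A, 0 ≤ a → 0 ≤ t.flip (star y * y) a := by
      intro a ha
      obtain ⟨x, rfl⟩ := CStarAlgebra.nonneg_iff_eq_star_mul_self.mp ha
      rw [LinearMap.flip_apply, ht.map_mul, ht.map_star]
      exact star_mul_self_nonneg _
    obtain ⟨K, hK⟩ := (PositiveLinearMap.mk₀ (t.flip (star y * y)) hpos).exists_norm_apply_le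
    exact ⟨K, hK⟩
  | zero => exact ⟨0, by simp⟩
  | add b b' _ _ hb hb' =>
    obtain ⟨K, hK⟩ := hb
    obtain ⟨K', hK'⟩ := hb'
    refine ⟨K + K', fun a => ?_⟩
    rw [map_add, add_mul]
    exact (norm_add_le _ _).trans (add_le_add (hK a) (hK' a))
  | smul z b _ hb =>
    obtain ⟨K, hK⟩ := hb
    refine ⟨‖z‖ * K, fun a => ?_⟩
    rw [map_smul, norm_smul, mul_assoc]
    gcongr
    exact hK a

/-- Separate boundedness becomes joint boundedness by Banach–Steinhaus, applied to the operators
$t(\cdot,b)$ with $b$ in the unit ball. -/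
theorem exists_bound (ht : IsStarBilinear t) :
    ∃ K : ℝ, 0 ≤ K ∧ ∀ a b, ‖t a b‖ ≤ K * ‖a‖ * ‖b‖ := by
  choose K hK using ht.exists_bound_left
  let f : Metric.closedBall (0 : B) 1 → A →L[ℂ] C := fun b =>
    (t.flip b.1).mkContinuous (K b.1) (hK b.1)
  obtain ⟨M, hM⟩ := banach_steinhaus (g := f) fun a => by
    obtain ⟨K', hK'⟩ := ht.flip.exists_bound_left a
    refine ⟨|K'|, fun b => (hK' b.1).trans ?_⟩
    have hb : ‖b.1‖ ≤ 1 := mem_closedBall_zero_iff.mp b.2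
    calc K' * ‖b.1‖ ≤ |K'| * 1 := by gcongr; exact le_abs_self _
      _ = |K'| := mul_one _
  refine ⟨|M|, abs_nonneg _, fun a b => ?_⟩
  rcases eq_or_ne b 0 with rfl | hb
  · simp
  have hpos : 0 < ‖b‖ := norm_pos_iff.mpr hb
  have hb1 : ‖(‖b‖⁻¹ : ℂ) • b‖ ≤ 1 := by rw [norm_smul]; simp [hpos.ne']
  have h1 : ‖t a ((‖b‖⁻¹ : ℂ) • b)‖ ≤ |M| * ‖a‖ :=
    ((f ⟨_, mem_closedBall_zero_iff.mpr hb1⟩).le_opNorm a).trans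
      (by gcongr; exact (hM _).trans (le_abs_self M))
  rwa [map_smul, norm_smul, norm_inv, Complex.norm_real, norm_norm, inv_mul_le_iff₀ hpos,
    mul_comm] at h1

/-- Since $t(a,b)^2=t(a^2,b^2)$, the joint bound `K` controls $\|t(a,b)\|^{2^k}$ for every $k$, so
the constant improves to $1$. -/
theorem norm_le_one (ht : IsStarBilinear t) {a : A} {b : B} (ha : IsSelfAdjoint a)
    (hb : IsSelfAdjoint b) (ha1 : ‖a‖ ≤ 1) (hb1 : ‖b‖ ≤ 1) : ‖t a b‖ ≤ 1 := by
  obtain ⟨K, hK0, hK⟩ := ht.exists_bound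
  have key : ∀ (k : ℕ) (a : A) (b : B), IsSelfAdjoint a → IsSelfAdjoint b → ‖a‖ ≤ 1 → ‖b‖ ≤ 1 →
      ‖t a b‖ ^ 2 ^ k ≤ K := by
    intro k
    induction k with
    | zero =>
      intro a b _ _ ha hb
      rw [pow_zero, pow_one]
      calc _ ≤ K * ‖a‖ * ‖b‖ := hK a b
        _ ≤ K * 1 * 1 := by gcongr
        _ = K := by ring
    | succ k ih =>
      intro a b ha hb ha1 hb1
      have hs : IsSelfAdjoint (t a b) := by
        rw [IsSelfAdjoint, ← ht.map_star, ha.star_eq, hb.star_eq]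
      rw [pow_succ', pow_mul, ← hs.norm_mul_self, ← ht.map_mul]
      refine ih _ _ ?_ ?_ ((norm_mul_le _ _).trans (mul_le_one₀ ha1 (norm_nonneg _) ha1))
        ((norm_mul_le _ _).trans (mul_le_one₀ hb1 (norm_nonneg _) hb1))
      · rw [IsSelfAdjoint, star_mul, ha.star_eq]
      · rw [IsSelfAdjoint, star_mul, hb.star_eq]
  by_contra! h
  obtain ⟨k, hk⟩ := pow_unbounded_of_one_lt K h
  have h1 : ‖t a b‖ ^ k ≤ ‖t a b‖ ^ 2 ^ k := pow_le_pow_right₀ h.le Nat.lt_two_pow_self.le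
  exact absurd (key k a b ha hb ha1 hb1) (not_le.mpr (hk.trans_le h1))

/-- The map `(x, y) ↦ (t (x n) (y n))ₙ` on bounded sequences. -/
def bddSeq (ht : IsStarBilinear t) (x : BddSeq A) (y : BddSeq B) : BddSeq C :=
  BddSeq.mk (fun n => t (x n) (y n)) (ht.exists_bound.choose * ‖x‖ * ‖y‖) fun n => by
    have h := ht.exists_bound.choose_spec
    refine (h.2 (x n) (y n)).trans ?_
    have h0 := h.1
    gcongr
    · exact BddSeq.norm_apply_le x n
    · exact BddSeq.norm_apply_le y n

/-- The bilinear map `A_∞ × B_∞ → C_∞` induced by `t`. -/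
def seqAlg (ht : IsStarBilinear t) : SeqAlg A → SeqAlg B → SeqAlg C :=
  Quotient.map₂ ht.bddSeq (by
    intro x x' hx y y' hy
    have hx' : Filter.Tendsto (fun n => ‖x n - x' n‖) Filter.atTop (nhds 0) :=
      (Submodule.quotientRel_def _).mp hx
    have hy' : Filter.Tendsto (fun n => ‖y n - y' n‖) Filter.atTop (nhds 0) :=
      (Submodule.quotientRel_def _).mp hy
    refine (Submodule.quotientRel_def _).mpr ?_
    change Filter.Tendsto (fun n => ‖t (x n) (y n) - t (x' n) (y' n)‖) Filter.atTop (nhds 0)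
    obtain ⟨K, hK0, hK⟩ := ht.exists_bound
    refine squeeze_zero (g := fun n => K * ‖x n - x' n‖ * ‖y‖ + K * ‖x'‖ * ‖y n - y' n‖)
      (fun _ => norm_nonneg _) (fun n => ?_) ?_
    · have h1 : t (x n) (y n) - t (x' n) (y' n) = t (x n - x' n) (y n) + t (x' n) (y n - y' n) := by
        simp
      rw [h1]
      refine (norm_add_le _ _).trans (add_le_add ((hK _ _).trans ?_) ((hK _ _).trans ?_))
      · gcongr
        exact BddSeq.norm_apply_le y n
      · gcongr
        exact BddSeq.norm_apply_le x' n
    · simpa using ((hx'.const_mul K).mul_const ‖y‖).add (hy'.const_mul (K * ‖x'‖)))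

theorem seqAlg_proj (ht : IsStarBilinear t) (x : BddSeq A) (y : BddSeq B) :
    ht.seqAlg ((c0Ideal A).proj x) ((c0Ideal B).proj y) = (c0Ideal C).proj (ht.bddSeq x y) := rfl

theorem seqAlg_mul (ht : IsStarBilinear t) (x x' : SeqAlg A) (y y' : SeqAlg B) :
    ht.seqAlg x y * ht.seqAlg x' y' = ht.seqAlg (x * x') (y * y') := by
  obtain ⟨x, rfl⟩ := (c0Ideal A).proj_surjective x
  obtain ⟨x', rfl⟩ := (c0Ideal A).proj_surjective x'
  obtain ⟨y, rfl⟩ := (c0Ideal B).proj_surjective y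
  obtain ⟨y', rfl⟩ := (c0Ideal B).proj_surjective y'
  exact congrArg (c0Ideal C).proj (lp.ext (funext fun n => (ht.map_mul _ _ _ _).symm))

/-- `seqAlg` as an additive map in the first variable. -/
def seqAlgHom (ht : IsStarBilinear t) (y : SeqAlg B) : SeqAlg A →+ SeqAlg C :=
  AddMonoidHom.mk' (fun x => ht.seqAlg x y) (by
    intro x x'
    obtain ⟨x, rfl⟩ := (c0Ideal A).proj_surjective x
    obtain ⟨x', rfl⟩ := (c0Ideal A).proj_surjective x'
    obtain ⟨y, rfl⟩ := (c0Ideal B).proj_surjective y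
    refine congrArg (c0Ideal C).proj (lp.ext (funext fun n => ?_))
    change t (x n + x' n) (y n) = t (x n) (y n) + t (x' n) (y n)
    rw [map_add, LinearMap.add_apply])

theorem seqAlgHom_apply (ht : IsStarBilinear t) (x : SeqAlg A) (y : SeqAlg B) :
    ht.seqAlgHom y x = ht.seqAlg x y := rfl

theorem isSelfAdjoint_seqAlg (ht : IsStarBilinear t) {x : SeqAlg A} {y : SeqAlg B}
    (hx : IsSelfAdjoint x) (hy : IsSelfAdjoint y) : IsSelfAdjoint (ht.seqAlg x y) := by
  have h : star (ht.seqAlg x y) = ht.seqAlg (star x) (star y) := by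
    obtain ⟨x, rfl⟩ := (c0Ideal A).proj_surjective x
    obtain ⟨y, rfl⟩ := (c0Ideal B).proj_surjective y
    exact congrArg (c0Ideal C).proj (lp.ext (funext fun n => (ht.map_star _ _).symm))
  rw [IsSelfAdjoint, h, hx.star_eq, hy.star_eq]

theorem norm_seqAlg_le_one (ht : IsStarBilinear t) {x : SeqAlg A} {y : SeqAlg B}
    (hx : IsSelfAdjoint x) (hy : IsSelfAdjoint y) (hx1 : ‖x‖ ≤ 1) (hy1 : ‖y‖ ≤ 1) :
    ‖ht.seqAlg x y‖ ≤ 1 := by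
  obtain ⟨x, hx', hx1', rfl⟩ := (c0Ideal A).exists_selfAdjoint_lift hx hx1
  obtain ⟨y, hy', hy1', rfl⟩ := (c0Ideal B).exists_selfAdjoint_lift hy hy1
  rw [seqAlg_proj]
  refine ((c0Ideal C).norm_proj_le _).trans (lp.norm_le_of_forall_le zero_le_one fun n => ?_)
  exact ht.norm_le_one (hx'.map (BddSeq.eval n)) (hy'.map (BddSeq.eval n))
    ((BddSeq.norm_apply_le x n).trans hx1') ((BddSeq.norm_apply_le y n).trans hy1')

variable {G : Type*} [Group G] {P : Prop} {H : Subgroup G} [H.FiniteIndex] {d : ℕ}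

attribute [local instance] Subgroup.fintypeQuotientOfFiniteIndex

theorem seqAlg_action (ht : IsStarBilinear t) {α : CStarAction G A} {β : CStarAction G B}
    {γ : CStarAction G C} (hγ : ∀ g a b, γ g (t a b) = t (α g a) (β g b)) (g : G)
    (x : SeqAlg A) (y : SeqAlg B) :
    γ.seqAlg g (ht.seqAlg x y) = ht.seqAlg (α.seqAlg g x) (β.seqAlg g y) := by
  obtain ⟨x, rfl⟩ := (c0Ideal A).proj_surjective x
  obtain ⟨y, rfl⟩ := (c0Ideal B).proj_surjective y
  exact congrArg (c0Ideal C).proj (lp.ext (funext fun n => hγ g (x n) (y n)))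

/-- In the second leg all products of `e` with `b` collapse to `b`. For equivariance this needs
$\beta_g(e^2)b=b$, which follows from `e` being a unit at $\beta_g^{-1}(b)$. -/
theorem eval_seqAlg (ht : IsStarBilinear t) {α : CStarAction G A} {β : CStarAction G B}
    {γ : CStarAction G C} (hγ : ∀ g a b, γ g (t a b) = t (α g a) (β g b))
    (c : Fin (d + 1) → G ⧸ H → SeqAlg A) (a : SeqAlg A) {e b : SeqAlg B}
    (heb : ∀ g, e * β.seqAlg g b = β.seqAlg g b) (hbe : b * e = b) (r : TowerRel P H d) :
    r.eval γ.seqAlg (fun l x => ht.seqAlg (c l x) e) (ht.seqAlg a b)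
      = ht.seqAlg (r.eval α.seqAlg c a) b := by
  have heb1 : e * b = b := by simpa using heb 1
  have hee : ∀ g, e * e * β.seqAlg g b = β.seqAlg g b := fun g => by rw [mul_assoc, heb, heb]
  have hee1 : e * e * b = b := by simpa using hee 1
  have heee1 : e * e * (e * e) * b = b := by rw [mul_assoc, hee1, hee1]
  rw [← seqAlgHom_apply _ _ b]
  cases r with
  | sum =>
    change (∑ l, ∑ x, _) * _ - ht.seqAlg a b = ht.seqAlgHom b ((∑ l, ∑ x, _) * a - a)
    simp only [Finset.sum_mul, map_sub, map_sum, seqAlgHom_apply, seqAlg_mul, hee1]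
  | orth l x y h =>
    change _ * _ = ht.seqAlgHom b (_ * a)
    simp only [seqAlgHom_apply, seqAlg_mul, heee1]
  | equiv g l x =>
    change (_ - _) * _ = ht.seqAlgHom b ((_ - _) * a)
    have h3 : β.seqAlg g (β.seqAlg g⁻¹ b) = b := by simp [← StarAlgEquiv.mul_apply]
    have h4 : β.seqAlg g (e * e) * b = b := by
      conv_lhs => rw [← h3]
      rw [← _root_.map_mul, hee, h3]
    simp only [sub_mul, map_sub, seqAlgHom_apply, seqAlg_mul, ht.seqAlg_action hγ, hee1, h4]
  | central l x =>
    change _ * _ - _ * _ = ht.seqAlgHom b (_ * a - a * _)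
    simp only [map_sub, seqAlgHom_apply, seqAlg_mul, heb1, hbe]
  | comm k l x y hP h =>
    change (_ - _) * _ = ht.seqAlgHom b ((_ - _) * a)
    simp only [sub_mul, map_sub, seqAlgHom_apply, seqAlg_mul, heee1]

end IsStarBilinear

/-- Points in the closed span of `W` lie in the closed span of a countable subset of `W`. -/
theorem exists_countable_subset_closure_span {E : Type*} [NormedAddCommGroup E] [NormedSpace ℂ E]
    {S W : Set E} (hS : S.Countable) (h : S ⊆ closure (Submodule.span ℂ W : Set E)) :
    ∃ V ⊆ W, V.Countable ∧ S ⊆ closure (Submodule.span ℂ V : Set E) := by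
  have h1 : ∀ s : S, ∃ V ⊆ W, V.Countable ∧ (s : E) ∈ closure (Submodule.span ℂ V : Set E) := by
    intro s
    obtain ⟨u, hu, hlim⟩ := mem_closure_iff_seq_limit.mp (h s.2)
    choose V hVW hV using fun n => Submodule.mem_span_finite_of_mem_span (hu n)
    refine ⟨⋃ n, (V n : Set E), Set.iUnion_subset hVW,
      Set.countable_iUnion fun n => (V n).countable_toSet, ?_⟩
    exact mem_closure_of_tendsto hlim (.of_forall fun n =>
      Submodule.span_mono (Set.subset_iUnion (fun n => (V n : Set E)) n) (hV n))
  choose V hVW hVc hV using h1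
  have := hS.to_subtype
  refine ⟨⋃ s, V s, Set.iUnion_subset hVW, Set.countable_iUnion hVc, fun s hs => ?_⟩
  exact closure_mono (Submodule.span_mono (Set.subset_iUnion V ⟨s, hs⟩)) (hV ⟨s, hs⟩)

section TensorPermanence

variable {G : Type*} [Group G] {P : Prop} {H : Subgroup G} [H.FiniteIndex] {d : ℕ}
  {A B C : Type*} [NonUnitalCStarAlgebra A] [NonUnitalCStarAlgebra B] [NonUnitalCStarAlgebra C]

attribute [local instance] Subgroup.fintypeQuotientOfFiniteIndex

/-- Countably many elementary tensors suffice to approximate `S`. Pair a tower for their first legs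
with a sequence unit for the orbit of their second legs. -/
theorem HasSeqTowers.of_starBilinear [Countable G] {t : A →ₗ[ℂ] B →ₗ[ℂ] C}
    (ht : IsStarBilinear t) {α : CStarAction G A} {β : CStarAction G B} {γ : CStarAction G C}
    (hγ : ∀ g a b, γ g (t a b) = t (α g a) (β g b))
    (hdense : ∀ x, x ∈ closure (Submodule.span ℂ (Set.range fun p : A × B => t p.1 p.2) : Set C))
    (h : HasSeqTowers P α H d) : HasSeqTowers P γ H d := by
  intro S hS
  obtain ⟨V, hVW, hVc, hSV⟩ := exists_countable_subset_closure_span hS fun x _ => hdense x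
  have hVW' : ∀ v ∈ V, ∃ q : A × B, t q.1 q.2 = v := fun v hv => hVW hv
  choose! p hp using hVW'
  let T : Set B := ⋃ g : G, β g '' ((fun v => (p v).2) '' V)
  obtain ⟨c, hc⟩ := h ((fun v => (p v).1) '' V) (hVc.image _)
  obtain ⟨e, he, he1, hunit⟩ := exists_seq_unit (S := T)
    (Set.countable_iUnion fun g => (hVc.image _).image _)
  have hes : IsSelfAdjoint ((c0Ideal B).proj e) := he.map (c0Ideal B).proj
  have hc' : IsSeqTower P γ V fun l x => ht.seqAlg (c l x) ((c0Ideal B).proj e) := by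
    refine ⟨fun l x => ht.isSelfAdjoint_seqAlg (hc.isSelfAdjoint l x) hes,
      fun l x => ht.norm_seqAlg_le_one (hc.isSelfAdjoint l x) hes (hc.norm_le_one l x)
        (((c0Ideal B).norm_proj_le e).trans he1), fun r v hv => ?_⟩
    have hT : ∀ g, β g (p v).2 ∈ T := fun g =>
      Set.mem_iUnion.mpr ⟨g, _, ⟨v, hv, rfl⟩, rfl⟩
    rw [← hp v hv]
    change r.eval γ.seqAlg _ (ht.seqAlg (constSeq (p v).1) (constSeq (p v).2)) = 0
    rw [ht.eval_seqAlg hγ c _ (fun g => (hunit _ (hT g)).1) (by simpa using (hunit _ (hT 1)).2),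
      hc.eval_eq_zero r _ ⟨v, hv, rfl⟩, ← ht.seqAlgHom_apply, map_zero]
  exact ⟨_, hc'.mono hSV⟩

/-- The bilinear map `(a, b) ↦ j (a ⊗ b)`. -/
def tensorBilin (j : A ⊗[ℂ] B →⋆ₙₐ[ℂ] C) : A →ₗ[ℂ] B →ₗ[ℂ] C :=
  (TensorProduct.mk ℂ A B).compr₂ (j : A ⊗[ℂ] B →ₗ[ℂ] C)

theorem tensorBilin_apply (j : A ⊗[ℂ] B →⋆ₙₐ[ℂ] C) (a : A) (b : B) :
    tensorBilin j a b = j (a ⊗ₜ b) := rfl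

theorem isStarBilinear_tensorBilin (j : A ⊗[ℂ] B →⋆ₙₐ[ℂ] C) : IsStarBilinear (tensorBilin j) where
  map_mul a a' b b' := by
    simp only [tensorBilin_apply, ← map_mul, Algebra.TensorProduct.tmul_mul_tmul]
  map_star a b := by
    simp only [tensorBilin_apply, ← map_star, TensorProduct.star_tmul]

theorem IsTensorCompletion.mem_closure_span {j : A ⊗[ℂ] B →⋆ₙₐ[ℂ] C} (hj : IsTensorCompletion j)
    (x : C) :
    x ∈ closure (Submodule.span ℂ (Set.range fun p : A × B => tensorBilin j p.1 p.2) : Set C) := by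
  refine closure_mono ?_ (hj.denseRange x)
  rintro _ ⟨u, rfl⟩
  induction u using TensorProduct.induction_on with
  | zero => rw [map_zero]; exact zero_mem _
  | tmul a b => exact Submodule.subset_span ⟨(a, b), rfl⟩
  | add u v hu hv => rw [map_add]; exact add_mem hu hv

end TensorPermanence

/-! ### Rokhlin dimensions -/

section Dimensions

variable {G : Type*} [Group G] [Countable G] {A B : Type*} [NonUnitalCStarAlgebra A]
  [NonUnitalCStarAlgebra B]

theorem rokhlinDimRelLE_iff {α : CStarAction G A} {H : Subgroup G} [H.FiniteIndex] {d : ℕ} :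
    RokhlinDimRelLE α H d ↔ HasSeqTowers False α H d :=
  rokhlinLE_false_iff.symm.trans rokhlinLE_iff_hasSeqTowers

theorem rokhlinDimCommRelLE_iff {α : CStarAction G A} {H : Subgroup G} [H.FiniteIndex] {d : ℕ} :
    RokhlinDimCommRelLE α H d ↔ HasSeqTowers True α H d :=
  rokhlinLE_true_iff.symm.trans rokhlinLE_iff_hasSeqTowers

theorem rokhlinDims_le_of_hasSeqTowers {α : CStarAction G A} {β : CStarAction G B}
    (h : ∀ (P : Prop) (H : Subgroup G) [H.FiniteIndex] (d : ℕ),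
      HasSeqTowers P α H d → HasSeqTowers P β H d) :
    rokhlinDim β ≤ rokhlinDim α ∧ rokhlinDimComm β ≤ rokhlinDimComm α := by
  constructor
  · refine iSup₂_mono fun H hH => le_iInf₂ fun d hd => iInf₂_le d ?_
    exact rokhlinDimRelLE_iff.mpr (h _ _ _ (rokhlinDimRelLE_iff.mp hd))
  · refine iSup₂_mono fun H hH => le_iInf₂ fun d hd => iInf₂_le d ?_
    exact rokhlinDimCommRelLE_iff.mpr (h _ _ _ (rokhlinDimCommRelLE_iff.mp hd))

/-- If `q d` holds whenever `p n d` holds for infinitely many `n`, then the least `d` with `q d`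
is at most the limit inferior of the least `d` with `p n d`. -/
theorem iInf_le_liminf_of_frequently {p : ℕ → ℕ → Prop} {q : ℕ → Prop} {u : ℕ → ℕ∞}
    (hu : ∀ n, ⨅ (d : ℕ) (_ : p n d), (d : ℕ∞) ≤ u n)
    (hq : ∀ d, (∃ᶠ n in Filter.atTop, p n d) → q d) :
    ⨅ (d : ℕ) (_ : q d), (d : ℕ∞) ≤ Filter.liminf u Filter.atTop := by
  rcases eq_or_ne (Filter.liminf u Filter.atTop) ⊤ with h | h
  · rw [h]; exact le_top
  obtain ⟨m, hm⟩ := ENat.ne_top_iff_exists.mp h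
  rw [← hm]
  -- With `m` the finite limit inferior, values below `m + 1` occur infinitely often, so some `d ≤
  -- m` is available each time; by pigeonhole one `d` recurs infinitely often.
  have h1 : ∃ᶠ n in Filter.atTop, u n < (m + 1 : ℕ) :=
    Filter.frequently_lt_of_liminf_lt (by isBoundedDefault)
      (by rw [← hm]; exact_mod_cast Nat.lt_succ_self m)
  have h2 : ∃ᶠ n in Filter.atTop, ∃ d ∈ Finset.range (m + 1), p n d := by
    refine h1.mono fun n hn => ?_
    obtain ⟨d, hd⟩ := iInf_lt_iff.mp ((hu n).trans_lt hn)
    obtain ⟨hpd, hd⟩ := iInf_lt_iff.mp hd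
    exact ⟨d, Finset.mem_range.mpr (by exact_mod_cast hd), hpd⟩
  obtain ⟨d, hd, hpd⟩ : ∃ d ∈ Finset.range (m + 1), ∃ᶠ n in Filter.atTop, p n d := by
    by_contra! h3
    refine h2 (((Filter.eventually_all_finset _).mpr h3).mono fun n hn => ?_)
    rintro ⟨d, hd, hpd⟩
    exact hn d hd hpd
  refine (iInf₂_le d (hq d hpd)).trans ?_
  exact_mod_cast Nat.lt_succ_iff.mp (Finset.mem_range.mp hd)

end Dimensions

end

/-! ### The four permanence properties -/

theorem mainTheorem5 {G : Type*} [Group G] [Countable G] [Group.ResiduallyFinite G]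
    (hG : IsAmenableGroup G) :
    -- tensor products
    (∀ {A B C : Type*} [NonUnitalCStarAlgebra A] [NonUnitalCStarAlgebra B]
        [NonUnitalCStarAlgebra C] (α : CStarAction G A) (β : CStarAction G B)
        (γ : CStarAction G C) (j : A ⊗[ℂ] B →⋆ₙₐ[ℂ] C), IsTensorCompletion j →
        (∀ g a b, γ g (j (a ⊗ₜ b)) = j (α g a ⊗ₜ β g b)) →
        rokhlinDim γ ≤ min (rokhlinDim α) (rokhlinDim β) ∧
        rokhlinDimComm γ ≤ min (rokhlinDimComm α) (rokhlinDimComm β)) ∧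
    -- quotients by invariant ideals
    (∀ {A : Type*} [NonUnitalCStarAlgebra A] (α : CStarAction G A) (I : ClosedIdeal A)
        (hI : ∀ g, ∀ x ∈ I, α g x ∈ I),
        rokhlinDim (α.quotient I hI) ≤ rokhlinDim α ∧
        rokhlinDimComm (α.quotient I hI) ≤ rokhlinDimComm α) ∧
    -- invariant hereditary subalgebras
    (∀ {A : Type*} [NonUnitalCStarAlgebra A] (α : CStarAction G A)
        (D : NonUnitalStarSubalgebra ℂ A) [IsClosed (D : Set A)]
        (hD : ∀ g, ∀ x ∈ D, α g x ∈ D), IsHereditary D →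
        rokhlinDim (α.restrict D hD) ≤ rokhlinDim α ∧
        rokhlinDimComm (α.restrict D hD) ≤ rokhlinDimComm α) ∧
    -- inductive limits
    (∀ {A : ℕ → Type*} [∀ n, NonUnitalCStarAlgebra (A n)] {L : Type*} [NonUnitalCStarAlgebra L]
        (ι : ∀ n, A n →⋆ₙₐ[ℂ] A (n + 1)) (μ : ∀ n, A n →⋆ₙₐ[ℂ] L)
        (α : ∀ n, CStarAction G (A n)) (αL : CStarAction G L),
        IsCStarInductiveLimit ι μ →
        (∀ n g a, ι n (α n g a) = α (n + 1) g (ι n a)) →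
        (∀ n g a, αL g (μ n a) = μ n (α n g a)) →
        rokhlinDim αL ≤ Filter.liminf (fun n => rokhlinDim (α n)) Filter.atTop ∧
        rokhlinDimComm αL ≤ Filter.liminf (fun n => rokhlinDimComm (α n)) Filter.atTop) := by
  refine ⟨?_, ?_, ?_, ?_⟩
  · intro A B C _ _ _ α β γ j hj hγ
    have ht := isStarBilinear_tensorBilin j
    have hα : rokhlinDim γ ≤ rokhlinDim α ∧ rokhlinDimComm γ ≤ rokhlinDimComm α :=
      rokhlinDims_le_of_hasSeqTowers fun _ _ _ _ h =>
        h.of_starBilinear (β := β) ht hγ hj.mem_closure_span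
    have hβ : rokhlinDim γ ≤ rokhlinDim β ∧ rokhlinDimComm γ ≤ rokhlinDimComm β :=
      rokhlinDims_le_of_hasSeqTowers fun _ _ _ _ h =>
        -- The bound by the second factor is the same argument with the tensor legs exchanged.
        h.of_starBilinear (β := α) ht.flip (fun g b a => hγ g a b) fun x => by
          refine closure_mono (Submodule.span_mono ?_) (hj.mem_closure_span x)
          rintro _ ⟨⟨a, b⟩, rfl⟩
          exact ⟨(b, a), rfl⟩
    exact ⟨le_min hα.1 hβ.1, le_min hα.2 hβ.2⟩
  · intro A _ α I hI
    exact rokhlinDims_le_of_hasSeqTowers fun _ _ _ _ h =>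
      h.of_surjective I.proj (fun _ _ => rfl) I.proj_surjective
  · intro A _ α D _ hD hher
    exact rokhlinDims_le_of_hasSeqTowers fun _ _ _ _ h => h.restrict D hD hher
  · intro A _ L _ ι μ α αL hL _ hμ
    constructor
    · refine iSup₂_le fun H hH => iInf_le_liminf_of_frequently
        (p := fun n d => RokhlinDimRelLE (α n) H d)
        (fun n => le_iSup₂
          (f := fun (K : Subgroup G) (_ : K.FiniteIndex) => rokhlinDimRel (α n) K) H hH)
        fun d hd => ?_
      simp only [rokhlinDimRelLE_iff] at hd ⊢
      exact HasSeqTowers.of_inductiveLimit hL hμ hd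
    · refine iSup₂_le fun H hH => iInf_le_liminf_of_frequently
        (p := fun n d => RokhlinDimCommRelLE (α n) H d)
        (fun n => le_iSup₂
          (f := fun (K : Subgroup G) (_ : K.FiniteIndex) => rokhlinDimCommRel (α n) K) H hH)
        fun d hd => ?_
      simp only [rokhlinDimCommRelLE_iff] at hd ⊢
      exact HasSeqTowers.of_inductiveLimit hL hμ hd
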